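/- **Theorem 2.1.** Let $D_0=-i(\alpha_1\partial_1+\alpha_2\partial_2)$ be the massless free Dirac operator on $L^2(\mathbb R^2;\mathbb C^2)$, where $\alpha_1=\begin{pmatrix}0&1\\1&0\end{pmatrix}$ and $\alpha_2=\begin{pmatrix}0&-i\\i&0\end{pmatrix}$, let $e^{-itD_0}$ and $\langle D_0\rangle^{-s}$ be defined by the functional calculus of $D_0$, and write $\langle x\rangle=(1+|x|^2)^{1/2}$. Let $\|T\|_{L^1\to L^\infty}$ be the supremum of $\|Tf\|_{L^\infty}$ over $f\in L^1\cap L^2$ with $\|f\|_{L^1}\le 1$. 1. For every $\varepsilon>0$ there is a constant $C=C(\varepsilon)$ such that, for all real $t\neq0$, $$\big\|e^{-itD_0}\langle D_0\rangle^{-\frac32-\varepsilon}\big\|_{L^1\to L^\infty}\le C\,|t|^{-\frac12}.$$ 2. For every $\varepsilon>0$ there is a constant $C=C(\varepsilon)$ such that, for all $0\le\gamma\le\frac32$ and all $t\in\mathbb R$, $$\big\|\langle x\rangle^{-\gamma}e^{-itD_0}\langle D_0\rangle^{-2-\varepsilon}\langle y\rangle^{-\gamma}\big\|_{L^1\to L^\infty}\le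 C\,\langle t\rangle^{-\frac12-\gamma},$$ where $\langle x\rangle^{-\gamma}$ and $\langle y\rangle^{-\gamma}$ denote multiplication by the weight after and before the evolution. -/

import Mathlib

open MeasureTheory FourierTransform
open scoped NNReal ENNReal SchwartzMap LineDeriv BoundedContinuousFunction

noncomputable section

namespace Dirac2D

/-- The plane `ℝ²` with its Euclidean norm. -/
abbrev Plane : Type := EuclideanSpace ℝ (Fin 2)

/-- The spinor space `ℂ²` with its Hermitian norm. -/
abbrev Spinor : Type := EuclideanSpace ℂ (Fin 2)

/-- `L²(ℝ²; ℂ²)`. -/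
abbrev L2 : Type := Lp Spinor 2 (volume : Measure Plane)

/-- The Dirac matrix `α₁`. -/
def alpha1 : Matrix (Fin 2) (Fin 2) ℂ := !![0, 1; 1, 0]

/-- The Dirac matrix `α₂`. -/
def alpha2 : Matrix (Fin 2) (Fin 2) ℂ := !![0, -Complex.I; Complex.I, 0]

/-- A `2 × 2` matrix acting on `ℂ²`. -/
abbrev act (A : Matrix (Fin 2) (Fin 2) ℂ) : Spinor →L[ℂ] Spinor :=
  Matrix.toEuclideanCLM (n := Fin 2) (𝕜 := ℂ) A

/-- The `k`-th standard basis vector of the plane. -/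
abbrev basisVec (k : Fin 2) : Plane := EuclideanSpace.single k (1 : ℝ)

/-- The massless free Dirac operator `D₀ = -i (α₁ ∂₁ + α₂ ∂₂)`, on the core of Schwartz
functions. -/
def freeDirac (f : 𝓢(Plane, Spinor)) : 𝓢(Plane, Spinor) :=
  (-Complex.I) •
    (SchwartzMap.postcompCLM (act alpha1) (∂_{basisVec 0} f)
      + SchwartzMap.postcompCLM (act alpha2) (∂_{basisVec 1} f))

/-- The Fourier symbol of `D₀`: the Hermitian matrix `2π (ξ₁ α₁ + ξ₂ α₂)`, for the Fourier transform
`𝓕 f ξ = ∫ exp (-2π i x·ξ) f x dx`. -/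
def diracSymbol (ξ : Plane) : Spinor →L[ℂ] Spinor :=
  act (((2 * Real.pi * ξ 0 : ℝ) : ℂ) • alpha1 + ((2 * Real.pi * ξ 1 : ℝ) : ℂ) • alpha2)

/-- The Fourier transform turns `D₀` into multiplication by its symbol. -/
theorem fourier_freeDirac (f : 𝓢(Plane, Spinor)) (ξ : Plane) :
    (𝓕 (freeDirac f)) ξ = diracSymbol ξ ((𝓕 f) ξ) := by
  have hpost (B : Spinor →L[ℂ] Spinor) (g : 𝓢(Plane, Spinor)) :
      (𝓕 (SchwartzMap.postcompCLM B g)) ξ = B ((𝓕 g) ξ) := by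
    rw [SchwartzMap.fourier_coe, SchwartzMap.fourier_coe, Real.fourier_eq, Real.fourier_eq,
      ← B.integral_comp_comm]
    · simp
    · exact (Real.fourierIntegral_convergent_iff ξ).2 g.integrable
  have hd (k : Fin 2) :
      (𝓕 (∂_{basisVec k} f)) ξ = ((2 * Real.pi * ξ k : ℝ) * Complex.I : ℂ) • (𝓕 f) ξ := by
    have htg : (inner ℝ · (basisVec k) : Plane → ℝ).HasTemperateGrowth :=
      ((innerSL ℝ).flip (basisVec k)).hasTemperateGrowth
    rw [SchwartzMap.fourier_lineDerivOp_eq]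
    have hin : inner ℝ ξ (basisVec k) = ξ k := by simp [EuclideanSpace.inner_single_right]
    rw [_root_.smul_apply, SchwartzMap.smulLeftCLM_apply_apply htg, hin, ← Complex.coe_smul,
      smul_smul]
    congr 1
    push_cast
    ring
  simp only [freeDirac, FourierTransform.fourier_smul, FourierTransform.fourier_add,
    _root_.smul_apply, _root_.add_apply, hpost, hd, diracSymbol, map_add, map_smul, smul_add,
    smul_smul]
  congr 2 <;> ring_nf <;> simp

/-- The matrix `φ (A ξ)`, where `A ξ` is the symbol of `D₀` and `φ` is applied by the functional
calculus of Hermitian matrices (the eigenvalues of `A ξ` are real). -/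
def calculusSymbol (φ : ℝ → ℂ) (ξ : Plane) : Spinor →L[ℂ] Spinor :=
  cfc (fun z : ℂ => φ z.re) (diracSymbol ξ)

theorem diracSymbol_mul_self (ξ : Plane) :
    diracSymbol ξ * diracSymbol ξ = (((2 * Real.pi * ‖ξ‖) ^ 2 : ℝ) : ℂ) • 1 := by
  have h : ‖ξ‖ ^ 2 = ξ 0 ^ 2 + ξ 1 ^ 2 := by
    rw [EuclideanSpace.real_norm_sq_eq, Fin.sum_univ_two]
  rw [mul_pow, h, diracSymbol, ← map_mul, ← map_one (Matrix.toEuclideanCLM (n := Fin 2) (𝕜 := ℂ)),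
    ← map_smul]
  congr 1
  ext i j
  fin_cases i <;> fin_cases j <;>
    simp [alpha1, alpha2, Matrix.mul_apply, Fin.sum_univ_two] <;> ring_nf <;> simp

theorem isSelfAdjoint_diracSymbol (ξ : Plane) : IsSelfAdjoint (diracSymbol ξ) := by
  rw [IsSelfAdjoint, diracSymbol, ← map_star]
  congr 1
  ext i j
  fin_cases i <;> fin_cases j <;> simp [alpha1, alpha2, Matrix.star_apply]

theorem continuous_diracSymbol : Continuous diracSymbol := by
  unfold diracSymbol
  simp only [map_add, map_smul]
  fun_prop

theorem spectrum_diracSymbol (ξ : Plane) {z : ℂ} (hz : z ∈ spectrum ℂ (diracSymbol ξ)) :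
    z = ((2 * Real.pi * ‖ξ‖ : ℝ) : ℂ) ∨ z = -((2 * Real.pi * ‖ξ‖ : ℝ) : ℂ) := by
  set k : ℝ := 2 * Real.pi * ‖ξ‖ with hk
  by_contra hcon
  push Not at hcon
  apply hz
  have hne : z ^ 2 - (k : ℂ) ^ 2 ≠ 0 := by
    rw [sq_sub_sq]
    exact mul_ne_zero (fun h => hcon.2 (eq_neg_of_add_eq_zero_left h)) (sub_ne_zero.2 hcon.1)
  have hsq := diracSymbol_mul_self ξ
  rw [← hk] at hsq
  push_cast at hsq
  have hc : Commute (algebraMap ℂ (Spinor →L[ℂ] Spinor) z) (diracSymbol ξ) :=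
    Algebra.commutes z (diracSymbol ξ)
  have hdiff : algebraMap ℂ (Spinor →L[ℂ] Spinor) z * algebraMap ℂ (Spinor →L[ℂ] Spinor) z -
      diracSymbol ξ * diracSymbol ξ = (z ^ 2 - (k : ℂ) ^ 2) • 1 := by
    rw [hsq, ← map_mul, Algebra.algebraMap_eq_smul_one, ← sub_smul, sq z]
  have h1 : (algebraMap ℂ _ z - diracSymbol ξ) * ((z ^ 2 - (k : ℂ) ^ 2)⁻¹ •
      (algebraMap ℂ _ z + diracSymbol ξ)) = 1 := by
    rw [mul_smul_comm, ← hc.mul_self_sub_mul_self_eq', hdiff, smul_smul, inv_mul_cancel₀ hne,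
      one_smul]
  have h2 : ((z ^ 2 - (k : ℂ) ^ 2)⁻¹ • (algebraMap ℂ _ z + diracSymbol ξ)) *
      (algebraMap ℂ _ z - diracSymbol ξ) = 1 := by
    rw [smul_mul_assoc, ← hc.mul_self_sub_mul_self_eq, hdiff, smul_smul, inv_mul_cancel₀ hne,
      one_smul]
  exact ⟨⟨_, _, h1, h2⟩, rfl⟩

theorem finite_spectrum_diracSymbol (ξ : Plane) : (spectrum ℂ (diracSymbol ξ)).Finite :=
  Set.Finite.subset (Set.toFinite {((2 * Real.pi * ‖ξ‖ : ℝ) : ℂ), -((2 * Real.pi * ‖ξ‖ : ℝ) : ℂ)})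
    fun _ hz => spectrum_diracSymbol ξ hz

/-- The spectral decomposition: the symbol has the eigenvalues `± 2π |ξ|`. -/
theorem calculusSymbol_eq (φ : ℝ → ℂ) (ξ : Plane) :
    calculusSymbol φ ξ =
      ((φ (2 * Real.pi * ‖ξ‖) + φ (-(2 * Real.pi * ‖ξ‖))) / 2) • 1 +
      ((φ (2 * Real.pi * ‖ξ‖) - φ (-(2 * Real.pi * ‖ξ‖))) / (2 * (2 * Real.pi * ‖ξ‖ : ℝ))) •
        diracSymbol ξ := by
  set k : ℝ := 2 * Real.pi * ‖ξ‖ with hk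
  have hn : IsStarNormal (diracSymbol ξ) := (isSelfAdjoint_diracSymbol ξ).isStarNormal
  set b : ℂ := (φ k - φ (-k)) / (2 * (k : ℝ)) with hb
  set a : ℂ := (φ k + φ (-k)) / 2 with ha
  have hspec : ∀ z ∈ spectrum ℂ (diracSymbol ξ), z = k ∨ z = -k := fun z hz =>
    spectrum_diracSymbol ξ hz
  have hcongr : calculusSymbol φ ξ = cfc (fun z : ℂ => a + b * z) (diracSymbol ξ) := by
    refine cfc_congr fun z hz => ?_
    by_cases hk0 : (k : ℂ) = 0
    · have hk1 : k = 0 := by exact_mod_cast hk0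
      rcases hspec z hz with rfl | rfl <;> simp [ha, hb, hk1]
    · rcases hspec z hz with rfl | rfl
      · simp [ha, hb]; field_simp; ring
      · simp [ha, hb]; field_simp; ring
  rw [hcongr, cfc_add (a := diracSymbol ξ) (fun _ : ℂ => a) (fun z => b * z),
    cfc_const a (diracSymbol ξ), cfc_const_mul_id b (diracSymbol ξ), Algebra.algebraMap_eq_smul_one]

theorem memLp_calculusSymbol (φ : ℝ →ᵇ ℂ) :
    MemLp (calculusSymbol φ) ∞ (volume : Measure Plane) := by
  have hval : calculusSymbol φ = fun ξ =>
      ((φ (2 * Real.pi * ‖ξ‖) + φ (-(2 * Real.pi * ‖ξ‖))) / 2) • (1 : Spinor →L[ℂ] Spinor) +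
      ((φ (2 * Real.pi * ‖ξ‖) - φ (-(2 * Real.pi * ‖ξ‖))) / (2 * (2 * Real.pi * ‖ξ‖ : ℝ))) •
        diracSymbol ξ := funext (calculusSymbol_eq φ)
  refine memLp_top_of_bound ?_ ‖φ‖ (Filter.Eventually.of_forall fun ξ => ?_)
  · rw [hval]
    have h1 : Continuous fun ξ : Plane => φ (2 * Real.pi * ‖ξ‖) := by fun_prop
    have h2 : Continuous fun ξ : Plane => φ (-(2 * Real.pi * ‖ξ‖)) := by fun_prop
    have h3 : Continuous fun ξ : Plane => ((2 * (2 * Real.pi * ‖ξ‖ : ℝ) : ℂ)) := by fun_prop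
    refine (((h1.add h2).div_const 2).smul continuous_const).aestronglyMeasurable.add ?_
    exact (((h1.sub h2).measurable.div h3.measurable).aestronglyMeasurable).smul
      continuous_diracSymbol.aestronglyMeasurable
  · exact norm_cfc_le (norm_nonneg φ) fun z _ => φ.norm_coe_le_norm _

/-- Multiplication by an essentially bounded matrix field, as a bounded operator on
`L²(ℝ²; ℂ²)`. -/
def mulOp (M : Plane → Spinor →L[ℂ] Spinor) (hM : MemLp M ∞ (volume : Measure Plane)) :
    L2 →L[ℂ] L2 :=
  (ContinuousLinearMap.id ℂ (Spinor →L[ℂ] Spinor)).holderL volume ∞ 2 2 hM.toLp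

/-- The operator `φ(D₀)` on `L²(ℝ²; ℂ²)` for a bounded continuous function `φ` on the line: the
Fourier transform diagonalises the self-adjoint operator `D₀`, and
`φ(D₀) = 𝓕⁻¹ φ(A(ξ)) 𝓕`. -/
def functionOfDirac (φ : ℝ →ᵇ ℂ) : L2 →L[ℂ] L2 :=
  (Lp.fourierTransformₗᵢ Plane Spinor).symm.toContinuousLinearEquiv.toContinuousLinearMap ∘L
    mulOp (calculusSymbol φ) (memLp_calculusSymbol φ) ∘L
    (Lp.fourierTransformₗᵢ Plane Spinor).toContinuousLinearEquiv.toContinuousLinearMap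

theorem fourier_functionOfDirac (φ : ℝ →ᵇ ℂ) (f : L2) :
    ∀ᵐ ξ, (𝓕 (functionOfDirac φ f) : L2) ξ = calculusSymbol φ ξ ((𝓕 f : L2) ξ) := by
  have h : (𝓕 (functionOfDirac φ f) : L2) =
      mulOp (calculusSymbol φ) (memLp_calculusSymbol φ) (𝓕 f : L2) :=
    (Lp.fourierTransformₗᵢ Plane Spinor).apply_symm_apply _
  rw [h]
  filter_upwards [(ContinuousLinearMap.id ℂ (Spinor →L[ℂ] Spinor)).coeFn_holder (r := 2)
    (memLp_calculusSymbol φ).toLp (𝓕 f : L2), (memLp_calculusSymbol φ).coeFn_toLp] with ξ h1 h2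
  refine Eq.trans h1 ?_
  rw [h2]
  rfl

/-- The functional calculus is multiplicative: `(φ χ)(D₀) = φ(D₀) χ(D₀)`. -/
theorem functionOfDirac_mul (φ χ : ℝ →ᵇ ℂ) :
    functionOfDirac (φ * χ) = functionOfDirac φ ∘L functionOfDirac χ := by
  ext1 f
  apply (Lp.fourierTransformₗᵢ Plane Spinor).injective
  refine Lp.ext ?_
  filter_upwards [fourier_functionOfDirac (φ * χ) f, fourier_functionOfDirac χ f,
    fourier_functionOfDirac φ (functionOfDirac χ f)] with ξ h1 h2 h3
  refine h1.trans (Eq.trans ?_ h3.symm)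
  rw [h2]
  have hfin : (spectrum ℂ (diracSymbol ξ)).Finite := finite_spectrum_diracSymbol ξ
  have : calculusSymbol (φ * χ : ℝ →ᵇ ℂ) ξ = calculusSymbol φ ξ * calculusSymbol χ ξ :=
    cfc_mul _ _ _ (hfin.continuousOn _) (hfin.continuousOn _)
  rw [this]
  rfl

/-- The calculus is that of `D₀`: if `χ(r) = r φ(r)` then `χ(D₀) f = φ(D₀) D₀ f` for Schwartz `f`. In
particular `(r ± i)⁻¹` is sent to the resolvent `(D₀ ± i)⁻¹`. -/
theorem functionOfDirac_freeDirac (φ χ : ℝ →ᵇ ℂ) (h : ∀ r : ℝ, χ r = r * φ r)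
    (f : 𝓢(Plane, Spinor)) :
    functionOfDirac χ (f.toLp 2) = functionOfDirac φ ((freeDirac f).toLp 2) := by
  apply (Lp.fourierTransformₗᵢ Plane Spinor).injective
  refine Lp.ext ?_
  have hF (g : 𝓢(Plane, Spinor)) : ∀ᵐ ξ, (𝓕 (g.toLp 2) : L2) ξ = (𝓕 g) ξ := by
    rw [SchwartzMap.toLp_fourier_eq]
    exact SchwartzMap.coeFn_toLp _ _ _
  filter_upwards [fourier_functionOfDirac χ (f.toLp 2),
    fourier_functionOfDirac φ ((freeDirac f).toLp 2), hF f, hF (freeDirac f)] with ξ h1 h2 h3 h4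
  refine h1.trans (Eq.trans ?_ h2.symm)
  rw [h3, h4, fourier_freeDirac]
  have hn : IsStarNormal (diracSymbol ξ) := (isSelfAdjoint_diracSymbol ξ).isStarNormal
  have hfin : (spectrum ℂ (diracSymbol ξ)).Finite := finite_spectrum_diracSymbol ξ
  have : calculusSymbol χ ξ = calculusSymbol φ ξ * diracSymbol ξ := by
    have hm := cfc_mul (a := diracSymbol ξ) (fun z : ℂ => φ z.re) (fun z : ℂ => z)
      (hfin.continuousOn _) (hfin.continuousOn _)
    rw [cfc_id' ℂ (diracSymbol ξ)] at hm
    refine Eq.trans (cfc_congr fun z hz => ?_) hm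
    have hre : ((z.re : ℝ) : ℂ) = z := by
      rcases spectrum_diracSymbol ξ hz with rfl | rfl <;> simp
    simp only [h, hre, mul_comm]
  rw [this]
  rfl

/-- The bracket `⟨r⟩ = (1 + r²)^{1/2}`. -/
def bracket (r : ℝ) : ℝ := Real.sqrt (1 + r ^ 2)

theorem one_le_bracket (r : ℝ) : 1 ≤ bracket r :=
  Real.one_le_sqrt.2 (by nlinarith [sq_nonneg r])

theorem continuous_bracket : Continuous bracket := by
  unfold bracket
  fun_prop

theorem continuous_bracket_rpow (s : ℝ) : Continuous fun r => bracket r ^ s :=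
  continuous_bracket.rpow_const fun r => Or.inl (zero_lt_one.trans_le (one_le_bracket r)).ne'

theorem norm_bracket_rpow_le (s : ℝ≥0) (r : ℝ) : ‖((bracket r ^ (-(s : ℝ)) : ℝ) : ℂ)‖ ≤ 1 := by
  rw [Complex.norm_real, Real.norm_of_nonneg
    (Real.rpow_nonneg (zero_le_one.trans (one_le_bracket r)) _)]
  exact Real.rpow_le_one_of_one_le_of_nonpos (one_le_bracket r) (neg_nonpos.2 s.coe_nonneg)

/-- The function `λ ↦ exp (-i t λ)`. -/
def phase (t : ℝ) : ℝ →ᵇ ℂ :=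
  BoundedContinuousFunction.ofNormedAddCommGroup
    (fun r : ℝ => Complex.exp (-Complex.I * (t : ℂ) * (r : ℂ))) (by fun_prop) 1 fun r => by
      rw [Complex.norm_exp]
      simp

/-- The function `λ ↦ ⟨λ⟩^{-s}`, for `s ≥ 0`. -/
def decay (s : ℝ≥0) : ℝ →ᵇ ℂ :=
  BoundedContinuousFunction.ofNormedAddCommGroup
    (fun r : ℝ => ((bracket r ^ (-(s : ℝ)) : ℝ) : ℂ))
    (Complex.continuous_ofReal.comp (continuous_bracket_rpow _)) 1 (norm_bracket_rpow_le s)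

/-- The free Dirac evolution `e^{-itD₀}`. -/
def evolution (t : ℝ) : L2 →L[ℂ] L2 := functionOfDirac (phase t)

/-- The smoothing operator `⟨D₀⟩^{-s}`, for `s ≥ 0`. -/
def smoothing (s : ℝ≥0) : L2 →L[ℂ] L2 := functionOfDirac (decay s)

/-- The matrix field `⟨x⟩^{-γ} · 1`, for `γ ≥ 0`. -/
def weightField (γ : ℝ≥0) (x : Plane) : Spinor →L[ℂ] Spinor :=
  ((bracket ‖x‖ ^ (-(γ : ℝ)) : ℝ) : ℂ) • 1

theorem memLp_weightField (γ : ℝ≥0) :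
    MemLp (weightField γ) ∞ (volume : Measure Plane) := by
  refine memLp_top_of_bound (Continuous.aestronglyMeasurable ?_) 1
    (Filter.Eventually.of_forall fun x => ?_)
  · exact (Complex.continuous_ofReal.comp
      ((continuous_bracket_rpow _).comp continuous_norm)).smul continuous_const
  · rw [weightField, norm_smul, norm_one, mul_one]
    exact norm_bracket_rpow_le γ ‖x‖

/-- Multiplication by the weight `⟨x⟩^{-γ}` on `L²(ℝ²; ℂ²)`, for `γ ≥ 0`. -/
def weight (γ : ℝ≥0) : L2 →L[ℂ] L2 := mulOp (weightField γ) (memLp_weightField γ)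

/-- The norm `‖T‖_{L¹ → L^∞}` (possibly infinite) of an operator `T` bounded on `L²`: the supremum
of `‖T f‖_{L^∞}` over `f ∈ L¹ ∩ L²` with `‖f‖_{L¹} ≤ 1`. As `L¹ ∩ L²` is dense in `L¹`, it is finite
if and only if `T` extends from `L¹ ∩ L²` to a bounded operator `L¹ → L^∞`, and then it is the norm
of the extension. -/
def normL1Linfty (T : L2 →L[ℂ] L2) : ℝ≥0∞ :=
  ⨆ (f : L2) (_ : eLpNorm f 1 (volume : Measure Plane) ≤ 1),
    eLpNorm (T f) ∞ (volume : Measure Plane)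

end Dirac2D

end

/-! The symbol of `D₀` at `ξ` has the two eigenvalues `± 2π|ξ|`, with spectral projections depending
only on the direction of `ξ`. In polar coordinates the convolution kernel of `e^{-itD₀}⟨D₀⟩^{-s}` at
`x` is therefore bounded by two angular integrals, one for each sign of `t`, of a single
one-dimensional profile evaluated at `|x| cos θ ∓ t`. The profile is a boundary value of the Laplace
transform of `k⟨k⟩^{-s}`. To make the integrals converge absolutely, `e^{-δ|λ|}` is inserted. It
moves the Laplace variable to real part `δ > 0`; every estimate is uniform in `δ`, and strong
convergence together with lower semicontinuity of the `L¹ → L^∞` norm removes it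
(`normL1Linfty_weighted_evolution_le`).

For `s > 3/2` one integration by parts away from the origin bounds the profile at `u` by both
`|u|^{-1/2+e}` and `|u|^{-1/2-e}` (`norm_laplace_amplitude_le_rpow`). The phase `|x| cos θ - t` is
at least of size `|t| (|θ| - φ)²` for some angle `φ` (`exists_sq_le_abs_mul_cos_sub`). After this
substitution the two powers become an integrable function of `√|t| (|θ| - φ)`, and scaling produces
`|t|^{-1/2}` (`integral_norm_comp_cos_le`). This is the first claim.

For `s > 2` the kernel is also bounded, and two integrations by parts give `O(t^{-2})` where `|x -
y| ≤ |t|/2`. Since `γ ≤ 3/2`, that decay suffices there without the weights. Where `|x - y| >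
|t|/2`, the product `⟨x⟩⟨y⟩` dominates `|x - y|`, so the weights supply the missing `|t|^{-γ}`.
Small times use only boundedness (`exists_weighted_kernel_le`). -/

noncomputable section

namespace Dirac2D

open Filter Topology Set

/-! ### Fourier integrals and the Plancherel transform on `L¹ ∩ L²`. -/

section FourierL1L2

variable {V F : Type*} [NormedAddCommGroup V] [InnerProductSpace ℝ V] [FiniteDimensional ℝ V]
  [MeasurableSpace V] [BorelSpace V] [NormedAddCommGroup F] [InnerProductSpace ℂ F]

theorem continuous_fourier_of_integrable {f : V → F} (hf : Integrable f) : Continuous (𝓕 f) :=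
  VectorFourier.fourierIntegral_continuous Real.continuous_fourierChar
    (by exact continuous_inner) hf

/-- On `L¹ ∩ L²` the Plancherel transform is given by the Fourier integral. -/
theorem coeFn_fourier_of_integrable [CompleteSpace F] (f : Lp F 2 (volume : Measure V))
    (hf : Integrable f) :
    ∀ᵐ ξ, (𝓕 f : Lp F 2 (volume : Measure V)) ξ = 𝓕 (f : V → F) ξ := by
  refine ae_eq_of_integral_contDiff_smul_eq
    ((Lp.memLp _).locallyIntegrable (by norm_num))
    (continuous_fourier_of_integrable hf).locallyIntegrable fun g hg hgc => ?_
  have hg₁ : HasCompactSupport (Complex.ofRealCLM ∘ g) := hgc.comp_left rfl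
  have hg₂ : ContDiff ℝ (⊤ : ℕ∞) (Complex.ofRealCLM ∘ g) := by fun_prop
  set G : 𝓢(V, ℂ) := hg₁.toSchwartzMap hg₂ with hG
  have hGg : ∀ x, G x = (g x : ℂ) := fun x => rfl
  -- Both transforms are tested against smooth compactly supported functions: the Plancherel side
  -- through tempered distributions, the integral side through the multiplication formula `∫ Ĝ f = ∫
  -- G f̂`.
  have h1 := congrArg (fun T => T G) (Lp.fourier_toTemperedDistribution_eq f)
  simp only [TemperedDistribution.fourier_apply, Lp.toTemperedDistribution_apply] at h1
  have h2 := VectorFourier.integral_fourierIntegral_smul_eq_flip (L := innerₗ V)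
    Real.continuous_fourierChar continuous_inner (G.integrable (μ := volume)) hf
  have hfl : (innerₗ V).flip = innerₗ V := by ext; simp
  rw [hfl] at h2
  have h3 : (∫ x, G x • (𝓕 f : Lp F 2 (volume : Measure V)) x) = ∫ x, G x • 𝓕 (f : V → F) x := by
    rw [← h1]
    exact h2
  simpa [hGg] using h3

/-- On `L¹ ∩ L²` the inverse Plancherel transform is given by the inverse Fourier integral. -/
theorem coeFn_fourierInv_of_integrable [CompleteSpace F] (f : Lp F 2 (volume : Measure V))
    (hf : Integrable f) :
    ∀ᵐ ξ, (𝓕⁻ f : Lp F 2 (volume : Measure V)) ξ = 𝓕⁻ (f : V → F) ξ := by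
  have hcont : Continuous (𝓕⁻ (f : V → F)) := by
    have : 𝓕⁻ (f : V → F) = fun x => 𝓕 (f : V → F) (-x) :=
      funext fun x => Real.fourierInv_eq_fourier_neg _ x
    rw [this]
    exact (continuous_fourier_of_integrable hf).comp continuous_neg
  refine ae_eq_of_integral_contDiff_smul_eq
    ((Lp.memLp _).locallyIntegrable (by norm_num)) hcont.locallyIntegrable fun g hg hgc => ?_
  have hg₁ : HasCompactSupport (Complex.ofRealCLM ∘ g) := hgc.comp_left rfl
  have hg₂ : ContDiff ℝ (⊤ : ℕ∞) (Complex.ofRealCLM ∘ g) := by fun_prop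
  set G : 𝓢(V, ℂ) := hg₁.toSchwartzMap hg₂ with hG
  have hGg : ∀ x, G x = (g x : ℂ) := fun x => rfl
  have h1 := congrArg (fun T => T G) (Lp.fourierInv_toTemperedDistribution_eq f)
  simp only [TemperedDistribution.fourierInv_apply, Lp.toTemperedDistribution_apply] at h1
  have h2 := VectorFourier.integral_fourierIntegral_smul_eq_flip (L := -innerₗ V)
    Real.continuous_fourierChar continuous_inner.neg
    (G.integrable (μ := volume)) hf
  have hfl : (-innerₗ V).flip = -innerₗ V := by ext; simp [real_inner_comm]
  rw [hfl] at h2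
  have h3 : (∫ x, G x • (𝓕⁻ f : Lp F 2 (volume : Measure V)) x) = ∫ x, G x • 𝓕⁻ (f : V → F) x := by
    rw [← h1, SchwartzMap.fourierInv_coe]
    exact h2
  simpa [hGg] using h3

end FourierL1L2

/-! ### Kernels and strong limits in the functional calculus. -/

/-- If the symbol of `φ(D₀)` is integrable, then `φ(D₀)` is the convolution with its inverse Fourier
transform. -/
theorem functionOfDirac_ae_eq_integral (φ : ℝ →ᵇ ℂ) (hφ : Integrable (calculusSymbol φ))
    (f : L2) (hf : Integrable f) :
    ∀ᵐ x, functionOfDirac φ f x = ∫ y, (𝓕⁻ (calculusSymbol φ) (x - y)) (f y) := by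
  have hF : (𝓕 (functionOfDirac φ f) : L2) =ᵐ[volume]
      fun ξ => calculusSymbol φ ξ (𝓕 (f : Plane → Spinor) ξ) := by
    filter_upwards [fourier_functionOfDirac φ f, coeFn_fourier_of_integrable f hf] with ξ h1 h2
    rw [h1, h2]
  have hprod : Integrable (fun p : Plane × Plane => calculusSymbol φ p.1 (f p.2))
      (volume.prod volume) := by
    refine (hφ.norm.mul_prod hf.norm).mono' ?_ (.of_forall fun p => ?_)
    · exact (ContinuousLinearMap.apply ℂ Spinor).aestronglyMeasurable_comp₂
        hf.aestronglyMeasurable.comp_snd hφ.aestronglyMeasurable.comp_fst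
    · exact (calculusSymbol φ p.1).le_opNorm _
  have hphase (x : Plane) : Integrable (fun p : Plane × Plane =>
      Real.fourierChar (inner ℝ p.1 (x - p.2)) • calculusSymbol φ p.1 (f p.2))
      (volume.prod volume) := by
    have hc : Continuous fun p : Plane × Plane =>
        ((Real.fourierChar (inner ℝ p.1 (x - p.2)) : Circle) : ℂ) := by fun_prop
    refine hprod.norm.mono' (hc.aestronglyMeasurable.smul hprod.aestronglyMeasurable)
      (.of_forall fun p => ?_)
    rw [Circle.smul_def, norm_smul, Circle.norm_coe, one_mul]
  -- Fubini: the matrix passes under the Fourier integral of `f`, and the two characters combine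
  -- into one at `x - y`.
  have hswap (x : Plane) : 𝓕⁻ (fun ξ => calculusSymbol φ ξ (𝓕 (f : Plane → Spinor) ξ)) x =
      ∫ y, (𝓕⁻ (calculusSymbol φ) (x - y)) (f y) := by
    have hin (ξ : Plane) : Real.fourierChar (inner ℝ ξ x) •
        calculusSymbol φ ξ (𝓕 (f : Plane → Spinor) ξ) =
        ∫ y, Real.fourierChar (inner ℝ ξ (x - y)) • calculusSymbol φ ξ (f y) := by
      rw [Real.fourier_eq, ← ContinuousLinearMap.integral_comp_comm _
        ((Real.fourierIntegral_convergent_iff ξ).2 hf), Circle.smul_def, ← integral_smul]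
      refine integral_congr_ae (.of_forall fun y => ?_)
      simp only [Circle.smul_def, map_smul, smul_smul]
      rw [inner_sub_right, sub_eq_add_neg, AddChar.map_add_eq_mul, Circle.coe_mul,
        real_inner_comm y ξ]
    rw [Real.fourierInv_eq]
    simp_rw [hin]
    rw [integral_integral_swap (hphase x)]
    refine integral_congr_ae (.of_forall fun y => ?_)
    have hint : Integrable (fun ξ : Plane =>
        Real.fourierChar (inner ℝ ξ (x - y)) • calculusSymbol φ ξ) := by
      have := (Real.fourierIntegral_convergent_iff (-(x - y))).2 hφ
      simpa only [inner_neg_right, neg_neg] using this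
    simp only [Real.fourierInv_eq]
    rw [ContinuousLinearMap.integral_apply hint]
    rfl
  have hI : Integrable (𝓕 (functionOfDirac φ f) : L2) := by
    refine Integrable.congr ?_ hF.symm
    refine (hφ.norm.mul_const (∫ y, ‖f y‖)).mono' ?_ (.of_forall fun ξ => ?_)
    · exact (Lp.aestronglyMeasurable _).congr hF
    · exact ((calculusSymbol φ ξ).le_opNorm _).trans (mul_le_mul_of_nonneg_left
        (VectorFourier.norm_fourierIntegral_le_integral_norm _ _ _ _ _) (norm_nonneg _))
  have hinv := coeFn_fourierInv_of_integrable _ hI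
  rw [FourierTransform.fourierInv_fourier_eq] at hinv
  filter_upwards [hinv] with x hx
  rw [hx, Real.fourierInv_congr_ae hF, hswap]

theorem norm_calculusSymbol_le {φ : ℝ → ℂ} {M : ℝ} (hM : 0 ≤ M) (ξ : Plane)
    (h : ∀ r, |r| = 2 * Real.pi * ‖ξ‖ → ‖φ r‖ ≤ M) : ‖calculusSymbol φ ξ‖ ≤ M := by
  refine norm_cfc_le hM fun z hz => h _ ?_
  have hp : 0 ≤ 2 * Real.pi * ‖ξ‖ := by positivity
  rcases spectrum_diracSymbol ξ hz with rfl | rfl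
  · rw [Complex.ofReal_re, abs_of_nonneg hp]
  · rw [Complex.neg_re, Complex.ofReal_re, abs_neg, abs_of_nonneg hp]

/-- By the explicit formula `calculusSymbol_eq`, only the values at the two eigenvalues enter, so no
uniformity in `r` is needed. -/
theorem tendsto_calculusSymbol {χ : ℕ → ℝ → ℂ} {φ : ℝ → ℂ}
    (h : ∀ r, Tendsto (fun n => χ n r) atTop (𝓝 (φ r))) (ξ : Plane) :
    Tendsto (fun n => calculusSymbol (χ n) ξ) atTop (𝓝 (calculusSymbol φ ξ)) := by
  simp only [calculusSymbol_eq]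
  exact (((((h _).add (h _)).div_const 2)).smul_const _).add
    ((((h _).sub (h _)).div_const _).smul_const _)

/-- Dominated convergence with majorant `(2M|g|)²`. -/
theorem tendsto_lintegral_calculusSymbol {χ : ℕ → ℝ →ᵇ ℂ} {φ : ℝ →ᵇ ℂ} {M : ℝ} (hM : 0 ≤ M)
    (hχ : ∀ n r, ‖χ n r‖ ≤ M) (hφ : ∀ r, ‖φ r‖ ≤ M)
    (h : ∀ r, Tendsto (fun n => χ n r) atTop (𝓝 (φ r))) {g : Plane → Spinor}
    (hg : MemLp g 2 volume) :
    Tendsto (fun n => ∫⁻ ξ, ‖calculusSymbol (χ n) ξ (g ξ) - calculusSymbol φ ξ (g ξ)‖ₑ ^ (2 : ℝ))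
      atTop (𝓝 0) := by
  have hmeas (ψ : ℝ →ᵇ ℂ) : AEStronglyMeasurable (fun ξ => calculusSymbol ψ ξ (g ξ)) volume :=
    (ContinuousLinearMap.apply ℂ Spinor).aestronglyMeasurable_comp₂ hg.aestronglyMeasurable
      (memLp_calculusSymbol ψ).aestronglyMeasurable
  rw [← lintegral_zero (μ := (volume : Measure Plane))]
  refine tendsto_lintegral_of_dominated_convergence'
    (fun ξ => (ENNReal.ofReal (2 * M) * ‖g ξ‖ₑ) ^ (2 : ℝ))
    (fun n => ?_) (fun n => .of_forall fun ξ => ?_) ?_ (.of_forall fun ξ => ?_)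
  · exact (((hmeas _).sub (hmeas _)).enorm).pow_const _
  · beta_reduce
    rw [← _root_.sub_apply]
    gcongr
    have hn : ‖calculusSymbol (χ n) ξ - calculusSymbol φ ξ‖ ≤ 2 * M := by
      rw [two_mul]
      exact (norm_sub_le _ _).trans (add_le_add
        (norm_calculusSymbol_le hM ξ fun r _ => hχ n r)
        (norm_calculusSymbol_le hM ξ fun r _ => hφ r))
    rw [← ofReal_norm, ← ofReal_norm, ← ENNReal.ofReal_mul (by positivity)]
    exact ENNReal.ofReal_le_ofReal
      ((ContinuousLinearMap.le_opNorm _ _).trans (by gcongr))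
  · have hfin := hg.eLpNorm_lt_top
    rw [eLpNorm_lt_top_iff_lintegral_rpow_enorm_lt_top (by norm_num) (by norm_num)] at hfin
    simp only [ENNReal.mul_rpow_of_nonneg _ _ (zero_le_two : (0 : ℝ) ≤ 2)]
    rw [lintegral_const_mul' _ _ (by finiteness)]
    exact (ENNReal.mul_lt_top (by finiteness) (by simpa using hfin)).ne
  · have hc : Tendsto (fun n => calculusSymbol (χ n) ξ (g ξ)) atTop
        (𝓝 (calculusSymbol φ ξ (g ξ))) :=
      ((ContinuousLinearMap.apply ℂ Spinor (g ξ)).continuous.tendsto _).comp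
        (tendsto_calculusSymbol h ξ)
    have h0 := ((hc.sub_const (calculusSymbol φ ξ (g ξ))).enorm).ennrpow_const 2
    simpa using h0

/-- Bounded pointwise convergence of functions implies strong convergence in the functional
calculus. -/
theorem tendsto_functionOfDirac {χ : ℕ → ℝ →ᵇ ℂ} {φ : ℝ →ᵇ ℂ} {M : ℝ} (hM : 0 ≤ M)
    (hχ : ∀ n r, ‖χ n r‖ ≤ M) (h : ∀ r, Tendsto (fun n => χ n r) atTop (𝓝 (φ r))) (f : L2) :
    Tendsto (fun n => functionOfDirac (χ n) f) atTop (𝓝 (functionOfDirac φ f)) := by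
  have hφ : ∀ r, ‖φ r‖ ≤ M := fun r =>
    le_of_tendsto (h r).norm (.of_forall fun n => hχ n r)
  have hfin : MemLp ((𝓕 f : L2) : Plane → Spinor) 2 volume := Lp.memLp _
  have hlim := tendsto_lintegral_calculusSymbol hM hχ hφ h hfin
  -- By Plancherel, convergence may be checked on the Fourier side.
  refine (Lp.fourierTransformₗᵢ Plane Spinor).isometry.isEmbedding.isInducing.tendsto_nhds_iff.2 ?_
  rw [Lp.tendsto_Lp_iff_tendsto_eLpNorm']
  have hroot := hlim.ennrpow_const (1 / 2 : ℝ)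
  rw [ENNReal.zero_rpow_of_pos (by norm_num)] at hroot
  refine hroot.congr fun n => ?_
  rw [eLpNorm_eq_lintegral_rpow_enorm_toReal (by norm_num) (by norm_num)]
  simp only [ENNReal.toReal_ofNat]
  congr 1
  refine lintegral_congr_ae ?_
  filter_upwards [fourier_functionOfDirac (χ n) f, fourier_functionOfDirac φ f] with ξ h1 h2
  rw [← h1, ← h2]
  rfl

/-- The norm `‖·‖_{L¹ → L^∞}` is lower semicontinuous for strong convergence. -/
theorem normL1Linfty_le_of_tendsto {S : ℕ → L2 →L[ℂ] L2} {T : L2 →L[ℂ] L2} {B : ℝ≥0∞}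
    (hS : ∀ f, Tendsto (fun n => S n f) atTop (𝓝 (T f))) (hB : ∀ n, normL1Linfty (S n) ≤ B) :
    normL1Linfty T ≤ B := by
  refine iSup₂_le fun f hf => ?_
  -- Convergence in `L²` gives an almost everywhere convergent subsequence, along which the
  -- essential supremum is lower semicontinuous.
  obtain ⟨ns, -, hns⟩ := (tendstoInMeasure_of_tendsto_Lp (hS f)).exists_seq_tendsto_ae
  have hbound : ∀ n, eLpNorm (S n f) ∞ (volume : Measure Plane) ≤ B := fun n =>
    (le_iSup₂ (f := fun (f : L2) (_ : eLpNorm f 1 (volume : Measure Plane) ≤ 1) =>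
      eLpNorm (S n f) ∞ (volume : Measure Plane)) f hf).trans (hB n)
  refine (Lp.eLpNorm_lim_le_liminf_eLpNorm (fun n => Lp.aestronglyMeasurable (S (ns n) f)) _
    hns).trans ?_
  exact (liminf_le_liminf (.of_forall fun n => hbound (ns n))).trans (by simp)

/-! ### Weights and weighted `L¹ → L^∞` bounds. -/

theorem mulOp_ae (M : Plane → Spinor →L[ℂ] Spinor) (hM : MemLp M ∞ (volume : Measure Plane))
    (f : L2) : ∀ᵐ x, mulOp M hM f x = M x (f x) := by
  filter_upwards [(ContinuousLinearMap.id ℂ (Spinor →L[ℂ] Spinor)).coeFn_holder (r := 2)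
    hM.toLp f, hM.coeFn_toLp] with x h1 h2
  refine Eq.trans h1 ?_
  rw [h2]
  rfl

theorem weight_ae (γ : ℝ≥0) (f : L2) :
    ∀ᵐ x, weight γ f x = ((bracket ‖x‖ ^ (-(γ : ℝ)) : ℝ) : ℂ) • f x := by
  filter_upwards [mulOp_ae (weightField γ) (memLp_weightField γ) f] with x hx
  refine hx.trans ?_
  simp [weightField]

theorem weight_zero : weight 0 = ContinuousLinearMap.id ℂ L2 := by
  ext1 f
  refine Lp.ext ?_
  filter_upwards [weight_ae 0 f] with x hx
  rw [hx]
  simp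

/-- A pointwise bound for the kernel of a weighted operator `⟨x⟩^{-γ} φ(D₀) ⟨y⟩^{-γ}` bounds its
norm from `L¹` to `L^∞`. -/
theorem normL1Linfty_weighted_le (φ : ℝ →ᵇ ℂ) (hφ : Integrable (calculusSymbol φ)) (γ : ℝ≥0)
    {B : ℝ≥0} (hB : ∀ x y : Plane, bracket ‖x‖ ^ (-(γ : ℝ)) * ‖𝓕⁻ (calculusSymbol φ) (x - y)‖ *
      bracket ‖y‖ ^ (-(γ : ℝ)) ≤ B) :
    normL1Linfty (weight γ ∘L functionOfDirac φ ∘L weight γ) ≤ B := by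
  have hw0 (x : Plane) : 0 ≤ bracket ‖x‖ ^ (-(γ : ℝ)) :=
    Real.rpow_nonneg (zero_le_one.trans (one_le_bracket _)) _
  refine iSup₂_le fun f hf => ?_
  have hfi : Integrable f := by
    rw [← memLp_one_iff_integrable]
    exact ⟨Lp.aestronglyMeasurable f, hf.trans_lt ENNReal.one_lt_top⟩
  have hf1 : ∫ y, ‖f y‖ ≤ 1 := by
    rw [integral_norm_eq_lintegral_enorm hfi.aestronglyMeasurable, ← eLpNorm_one_eq_lintegral_enorm]
    exact ENNReal.toReal_le_of_le_ofReal zero_le_one (by simpa using hf)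
  have hgi : Integrable (weight γ f) := by
    refine hfi.norm.mono' (Lp.aestronglyMeasurable _) ?_
    filter_upwards [weight_ae γ f] with x hx
    rw [hx, norm_smul]
    exact mul_le_of_le_one_left (norm_nonneg _) (norm_bracket_rpow_le γ ‖x‖)
  have hmain : ∀ᵐ x, ‖(weight γ ∘L functionOfDirac φ ∘L weight γ) f x‖ ≤ B := by
    filter_upwards [weight_ae γ (functionOfDirac φ (weight γ f)),
      functionOfDirac_ae_eq_integral φ hφ (weight γ f) hgi] with x h1 h2
    rw [ContinuousLinearMap.comp_apply, ContinuousLinearMap.comp_apply, h1, h2, ← integral_smul]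
    refine (norm_integral_le_of_norm_le (hfi.norm.const_mul (B : ℝ)) ?_).trans ?_
    · filter_upwards [weight_ae γ f] with y hy
      rw [hy, map_smul, norm_smul, norm_smul, Complex.norm_real, Complex.norm_real,
        Real.norm_of_nonneg (hw0 x), Real.norm_of_nonneg (hw0 y)]
      calc bracket ‖x‖ ^ (-(γ : ℝ)) * (bracket ‖y‖ ^ (-(γ : ℝ)) *
              ‖(𝓕⁻ (calculusSymbol φ) (x - y)) (f y)‖)
          ≤ bracket ‖x‖ ^ (-(γ : ℝ)) * (bracket ‖y‖ ^ (-(γ : ℝ)) *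
              (‖𝓕⁻ (calculusSymbol φ) (x - y)‖ * ‖f y‖)) := by
            have := hw0 x
            have := hw0 y
            gcongr
            exact ContinuousLinearMap.le_opNorm _ _
        _ = (bracket ‖x‖ ^ (-(γ : ℝ)) * ‖𝓕⁻ (calculusSymbol φ) (x - y)‖ *
              bracket ‖y‖ ^ (-(γ : ℝ))) * ‖f y‖ := by ring
        _ ≤ B * ‖f y‖ := by
            gcongr
            exact hB x y
    · rw [integral_const_mul]
      exact mul_le_of_le_one_right B.2 hf1
  refine (eLpNorm_exponent_top (f := _)).trans_le ?_
  refine eLpNormEssSup_le_of_ae_enorm_bound ?_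
  filter_upwards [hmain] with x hx
  rw [← ofReal_norm]
  exact ENNReal.ofReal_le_of_le_toReal (by simpa using hx)

/-! ### Laplace transforms in the right half-plane. -/

/-- The Laplace transform `∫₀^∞ e^{-zk} h(k) dk`. -/
def laplace (h : ℝ → ℝ) (z : ℂ) : ℂ := ∫ k in Ioi (0 : ℝ), Complex.exp (-z * k) * h k

theorem norm_exp_neg_mul (z : ℂ) (k : ℝ) : ‖Complex.exp (-z * k)‖ = Real.exp (-z.re * k) := by
  rw [Complex.norm_exp]
  simp

theorem norm_exp_neg_mul_le_one {z : ℂ} (hz : 0 < z.re) {k : ℝ} (hk : 0 ≤ k) :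
    ‖Complex.exp (-z * k)‖ ≤ 1 := by
  rw [norm_exp_neg_mul]
  exact Real.exp_le_one_iff.2 (by nlinarith)

theorem integrableOn_exp_neg_mul_of_bounded {z : ℂ} (hz : 0 < z.re) {g : ℝ → ℝ}
    (hg : Continuous g) {c B : ℝ} (hB : ∀ k, c < k → |g k| ≤ B) :
    IntegrableOn (fun k : ℝ => Complex.exp (-z * k) * g k) (Ioi c) := by
  refine ((exp_neg_integrableOn_Ioi c hz).const_mul B).mono'
    (by fun_prop) ?_
  filter_upwards [self_mem_ae_restrict measurableSet_Ioi] with k hk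
  rw [norm_mul, norm_exp_neg_mul, Complex.norm_real, Real.norm_eq_abs, mul_comm]
  exact mul_le_mul_of_nonneg_right (hB k hk) (Real.exp_pos _).le

/-- Integration by parts, each use gaining a factor `1/z`. The boundary term at infinity vanishes
because `Re z > 0` and `g` is bounded. The free lower limit `c` allows integrating by parts only on
the tail. -/
theorem mul_integral_exp_neg_mul {z : ℂ} (hz : 0 < z.re) {g g' : ℝ → ℝ} (hg : Continuous g)
    {c B : ℝ} (hd : ∀ k, c ≤ k → HasDerivAt g (g' k) k) (hB : ∀ k, c < k → |g k| ≤ B)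
    (hint : IntegrableOn (fun k : ℝ => Complex.exp (-z * k) * g' k) (Ioi c)) :
    z * ∫ k in Ioi c, Complex.exp (-z * k) * g k =
      Complex.exp (-z * c) * g c + ∫ k in Ioi c, Complex.exp (-z * k) * g' k := by
  have hint0 := integrableOn_exp_neg_mul_of_bounded hz hg hB
  have hderiv : ∀ k ∈ Ici c, HasDerivAt (fun k : ℝ => Complex.exp (-z * k) * g k)
      (-z * (Complex.exp (-z * k) * g k) + Complex.exp (-z * k) * g' k) k := by
    intro k hk
    have h1 : HasDerivAt (fun k : ℝ => Complex.exp (-z * k)) (Complex.exp (-z * k) * (-z)) k := by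
      have := ((Complex.ofRealCLM.hasDerivAt (x := k)).const_mul (-z)).cexp
      simpa using this
    refine (h1.mul (hd k hk).ofReal_comp).congr_deriv ?_
    ring
  have hlim : Tendsto (fun k : ℝ => Complex.exp (-z * k) * g k) atTop (𝓝 0) := by
    refine squeeze_zero_norm' (a := fun k : ℝ => Real.exp (-z.re * k) * B) ?_ ?_
    · filter_upwards [eventually_gt_atTop c] with k hk
      rw [norm_mul, norm_exp_neg_mul, Complex.norm_real, Real.norm_eq_abs]
      exact mul_le_mul_of_nonneg_left (hB k hk) (Real.exp_pos _).le
    · have h1 : Tendsto (fun k : ℝ => -z.re * k) atTop atBot :=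
        tendsto_id.const_mul_atTop_of_neg (by linarith)
      simpa using (Real.tendsto_exp_atBot.comp h1).mul_const B
  have hmain := integral_Ioi_of_hasDerivAt_of_tendsto' hderiv ((hint0.const_mul (-z)).add hint) hlim
  rw [integral_add (hint0.const_mul (-z)) hint, integral_const_mul] at hmain
  linear_combination -hmain

theorem mul_laplace {z : ℂ} (hz : 0 < z.re) {g g' : ℝ → ℝ} (hg : Continuous g)
    (hg' : Continuous g') {B B' : ℝ} (hd : ∀ k, HasDerivAt g (g' k) k)
    (hB : ∀ k, 0 < k → |g k| ≤ B) (hB' : ∀ k, 0 < k → |g' k| ≤ B') :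
    z * laplace g z = g 0 + laplace g' z := by
  have := mul_integral_exp_neg_mul hz hg (fun k _ => hd k) hB
    (integrableOn_exp_neg_mul_of_bounded hz hg' hB')
  simpa [laplace] using this

theorem norm_laplace_le_integral {z : ℂ} (hz : 0 < z.re) {g G : ℝ → ℝ}
    (hG : IntegrableOn G (Ioi 0)) (h : ∀ k, 0 < k → |g k| ≤ G k) :
    ‖laplace g z‖ ≤ ∫ k in Ioi (0 : ℝ), G k := by
  refine norm_integral_le_of_norm_le hG ?_
  filter_upwards [self_mem_ae_restrict measurableSet_Ioi] with k hk
  rw [norm_mul, Complex.norm_real, Real.norm_eq_abs]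
  exact (mul_le_of_le_one_left (abs_nonneg _) (norm_exp_neg_mul_le_one hz (le_of_lt hk))).trans
    (h k hk)

/-- If `h = O(k^{-a})` and `h' = O(k^{-a-1})` with `0 < a < 1`, then the Laplace transform of `h` is
`O(|z|^{a-1})` in the right half-plane. -/
theorem norm_laplace_le_rpow {h h' : ℝ → ℝ} {a A : ℝ} (ha0 : 0 < a) (ha1 : a < 1)
    (hc : Continuous h) (hc' : Continuous h') (hd : ∀ k, HasDerivAt h (h' k) k)
    (hA : ∀ k, 0 < k → |h k| ≤ A * k ^ (-a)) (hA' : ∀ k, 0 < k → |h' k| ≤ A * k ^ (-a - 1))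
    {z : ℂ} (hz : 0 < z.re) :
    ‖laplace h z‖ ≤ A * (1 / (1 - a) + 1 + 1 / a) * ‖z‖ ^ (a - 1) := by
  have hz0 : 0 < ‖z‖ := hz.trans_le ((le_abs_self _).trans (Complex.abs_re_le_norm z))
  have hA0 : 0 ≤ A := by
    have := (abs_nonneg _).trans (hA 1 one_pos)
    simpa using this
  -- The split is at the scale where `|z| k = 1`: below it the size of `h` is used directly, above
  -- it one integration by parts.
  set c : ℝ := ‖z‖⁻¹ with hcdef
  have hc0 : 0 < c := inv_pos.2 hz0
  have hcz : c ^ (1 - a) = ‖z‖ ^ (a - 1) := by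
    rw [hcdef, Real.inv_rpow hz0.le, ← Real.rpow_neg hz0.le, neg_sub]
  have hcz' : ‖z‖⁻¹ * c ^ (-a) = ‖z‖ ^ (a - 1) := by
    rw [← hcdef, ← hcz, Real.rpow_sub hc0, Real.rpow_neg hc0.le, Real.rpow_one]
    field_simp
  have hrint : IntegrableOn (fun k : ℝ => A * k ^ (-a)) (Ioc 0 c) :=
    ((intervalIntegrable_iff_integrableOn_Ioc_of_le hc0.le).1
      (intervalIntegral.intervalIntegrable_rpow' (by linarith))).const_mul A
  have hb1 : ∀ᵐ k : ℝ ∂(volume.restrict (Ioc 0 c)),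
      ‖Complex.exp (-z * k) * h k‖ ≤ A * k ^ (-a) := by
    filter_upwards [self_mem_ae_restrict measurableSet_Ioc] with k hk
    rw [norm_mul, Complex.norm_real, Real.norm_eq_abs]
    exact (mul_le_of_le_one_left (abs_nonneg _) (norm_exp_neg_mul_le_one hz hk.1.le)).trans
      (hA k hk.1)
  have hint1 : IntegrableOn (fun k : ℝ => Complex.exp (-z * k) * h k) (Ioc 0 c) :=
    hrint.mono' (by fun_prop) hb1
  have hI1 : ‖∫ k in Ioc 0 c, Complex.exp (-z * k) * h k‖ ≤ A * (1 / (1 - a)) * ‖z‖ ^ (a - 1) := by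
    refine (norm_integral_le_of_norm_le hrint hb1).trans_eq ?_
    rw [integral_const_mul, ← intervalIntegral.integral_of_le hc0.le,
      integral_rpow (Or.inl (by linarith)), Real.zero_rpow (by linarith), ← hcz,
      show -a + 1 = 1 - a by ring]
    ring
  have hB : ∀ k, c < k → |h k| ≤ A * c ^ (-a) := fun k hk =>
    (hA k (hc0.trans hk)).trans (mul_le_mul_of_nonneg_left
      (Real.rpow_le_rpow_of_nonpos hc0 hk.le (by linarith)) hA0)
  have hint2 := integrableOn_exp_neg_mul_of_bounded hz hc hB
  have hrint' : IntegrableOn (fun k : ℝ => A * k ^ (-a - 1)) (Ioi c) :=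
    (integrableOn_Ioi_rpow_of_lt (by linarith) hc0).const_mul A
  have hb2 : ∀ᵐ k : ℝ ∂(volume.restrict (Ioi c)),
      ‖Complex.exp (-z * k) * h' k‖ ≤ A * k ^ (-a - 1) := by
    filter_upwards [self_mem_ae_restrict measurableSet_Ioi] with k hk
    have hk0 : 0 < k := hc0.trans hk
    rw [norm_mul, Complex.norm_real, Real.norm_eq_abs]
    exact (mul_le_of_le_one_left (abs_nonneg _) (norm_exp_neg_mul_le_one hz hk0.le)).trans
      (hA' k hk0)
  have hint3 : IntegrableOn (fun k : ℝ => Complex.exp (-z * k) * h' k) (Ioi c) :=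
    hrint'.mono' (by fun_prop) hb2
  have hI3 : ‖∫ k in Ioi c, Complex.exp (-z * k) * h' k‖ ≤ A * (1 / a) * c ^ (-a) := by
    refine (norm_integral_le_of_norm_le hrint' hb2).trans_eq ?_
    rw [integral_const_mul, integral_Ioi_rpow_of_lt (by linarith) hc0,
      show -a - 1 + 1 = -a by ring, neg_div_neg_eq]
    ring
  have hI2 : ‖∫ k in Ioi c, Complex.exp (-z * k) * h k‖ ≤ A * (1 + 1 / a) * ‖z‖ ^ (a - 1) := by
    have hparts := mul_integral_exp_neg_mul hz hc (fun k _ => hd k) hB hint3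
    have hn : ‖z‖ * ‖∫ k in Ioi c, Complex.exp (-z * k) * h k‖ ≤ A * (1 + 1 / a) * c ^ (-a) := by
      rw [← norm_mul, hparts]
      refine (norm_add_le _ _).trans ?_
      have : ‖Complex.exp (-z * c) * h c‖ ≤ A * c ^ (-a) := by
        rw [norm_mul, Complex.norm_real, Real.norm_eq_abs]
        exact (mul_le_of_le_one_left (abs_nonneg _) (norm_exp_neg_mul_le_one hz hc0.le)).trans
          (hA c hc0)
      linarith [hI3]
    rw [← hcz']
    calc _ = ‖z‖⁻¹ * (‖z‖ * ‖∫ k in Ioi c, Complex.exp (-z * k) * h k‖) := by field_simp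
      _ ≤ ‖z‖⁻¹ * (A * (1 + 1 / a) * c ^ (-a)) := by gcongr
      _ = _ := by ring
  have hsplit : laplace h z = (∫ k in Ioc 0 c, Complex.exp (-z * k) * h k) +
      ∫ k in Ioi c, Complex.exp (-z * k) * h k := by
    rw [laplace, ← Ioc_union_Ioi_eq_Ioi hc0.le, setIntegral_union _ measurableSet_Ioi hint1 hint2]
    exact Ioc_disjoint_Ioi le_rfl
  rw [hsplit]
  refine (norm_add_le _ _).trans ((add_le_add hI1 hI2).trans_eq ?_)
  ring

/-! ### Symbol estimates for the radial amplitude and its Laplace transform. -/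

/-- The radial amplitude `k ⟨k⟩^{-s}`. -/
def amplitude (s k : ℝ) : ℝ := k * bracket k ^ (-s)

/-- The derivative of `amplitude s`. -/
def amplitudeDeriv (s k : ℝ) : ℝ := bracket k ^ (-s) - s * k ^ 2 * bracket k ^ (-s - 2)

/-- The second derivative of `amplitude s`. -/
def amplitudeDerivTwo (s k : ℝ) : ℝ :=
  -(3 * s) * k * bracket k ^ (-s - 2) + s * (s + 2) * k ^ 3 * bracket k ^ (-s - 4)

theorem bracket_pos (r : ℝ) : 0 < bracket r := zero_lt_one.trans_le (one_le_bracket r)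

theorem bracket_sq (r : ℝ) : bracket r ^ 2 = 1 + r ^ 2 := Real.sq_sqrt (by positivity)

theorem abs_le_bracket (r : ℝ) : |r| ≤ bracket r :=
  Real.abs_le_sqrt (by linarith)

theorem hasDerivAt_bracket_rpow (s k : ℝ) :
    HasDerivAt (fun k => bracket k ^ (-s)) (-s * k * bracket k ^ (-s - 2)) k := by
  have h1 : HasDerivAt bracket (k / bracket k) k := by
    have h2 : HasDerivAt (fun k : ℝ => 1 + k ^ 2) (2 * k) k := by
      simpa using (hasDerivAt_pow 2 k).const_add 1
    refine (h2.sqrt (by positivity)).congr_deriv ?_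
    rw [bracket]
    field_simp
  refine (h1.rpow_const (Or.inl (bracket_pos k).ne')).congr_deriv ?_
  rw [show -s - 1 = (-s - 2) + 1 by ring, Real.rpow_add_one (bracket_pos k).ne']
  have := (bracket_pos k).ne'
  field_simp

theorem hasDerivAt_amplitude (s k : ℝ) : HasDerivAt (amplitude s) (amplitudeDeriv s k) k := by
  refine ((hasDerivAt_id k).mul (hasDerivAt_bracket_rpow s k)).congr_deriv ?_
  simp only [amplitudeDeriv, id_eq]
  ring

theorem hasDerivAt_amplitudeDeriv (s k : ℝ) :
    HasDerivAt (amplitudeDeriv s) (amplitudeDerivTwo s k) k := by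
  have h2 := hasDerivAt_bracket_rpow (s + 2) k
  rw [show -(s + 2) = -s - 2 by ring, show -s - 2 - 2 = -s - 4 by ring] at h2
  refine ((hasDerivAt_bracket_rpow s k).sub
    (((hasDerivAt_pow 2 k).const_mul s).mul h2)).congr_deriv ?_
  simp only [amplitudeDerivTwo]
  push_cast
  ring

theorem continuous_amplitude (s : ℝ) : Continuous (amplitude s) :=
  continuous_iff_continuousAt.2 fun k => (hasDerivAt_amplitude s k).continuousAt

theorem continuous_amplitudeDeriv (s : ℝ) : Continuous (amplitudeDeriv s) :=
  continuous_iff_continuousAt.2 fun k => (hasDerivAt_amplitudeDeriv s k).continuousAt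

theorem continuous_amplitudeDerivTwo (s : ℝ) : Continuous (amplitudeDerivTwo s) := by
  have h1 := continuous_bracket_rpow (-s - 2)
  have h2 := continuous_bracket_rpow (-s - 4)
  unfold amplitudeDerivTwo
  fun_prop

/-- The bound `|k| ≤ ⟨k⟩` in the form that collapses each term of the amplitude and its derivatives
to a single power of `⟨k⟩`. -/
theorem abs_pow_mul_bracket_rpow_le (n : ℕ) (s k : ℝ) :
    |k| ^ n * bracket k ^ (s - n) ≤ bracket k ^ s := by
  rw [Real.rpow_sub_natCast (bracket_pos k).ne', mul_div_assoc']
  rw [div_le_iff₀ (pow_pos (bracket_pos k) n), mul_comm]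
  exact mul_le_mul_of_nonneg_left (pow_le_pow_left₀ (abs_nonneg k) (abs_le_bracket k) n)
    (Real.rpow_nonneg (bracket_pos k).le _)

theorem abs_amplitude (s k : ℝ) : |amplitude s k| = |k| * bracket k ^ (-s) := by
  rw [amplitude, abs_mul, abs_of_nonneg (Real.rpow_nonneg (bracket_pos k).le _)]

theorem abs_amplitude_le (s k : ℝ) : |amplitude s k| ≤ bracket k ^ (1 - s) := by
  have := abs_pow_mul_bracket_rpow_le 1 (1 - s) k
  rwa [abs_amplitude, ← pow_one |k|, show -s = 1 - s - (1 : ℕ) by push_cast; ring]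

theorem abs_amplitudeDeriv_le {s : ℝ} (hs : 0 ≤ s) (k : ℝ) :
    |amplitudeDeriv s k| ≤ (1 + s) * bracket k ^ (-s) := by
  have h := abs_pow_mul_bracket_rpow_le 2 (-s) k
  push_cast at h
  have h0 := Real.rpow_nonneg (bracket_pos k).le (-s)
  have h2 := Real.rpow_nonneg (bracket_pos k).le (-s - 2)
  rw [amplitudeDeriv]
  refine (abs_sub _ _).trans ?_
  rw [abs_of_nonneg h0, abs_mul, abs_mul, abs_of_nonneg hs, abs_of_nonneg h2, abs_pow, mul_assoc]
  nlinarith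

theorem abs_amplitudeDerivTwo_le {s : ℝ} (hs : 0 ≤ s) (k : ℝ) :
    |amplitudeDerivTwo s k| ≤ (3 * s + s * (s + 2)) * bracket k ^ (-s - 1) := by
  have h := abs_pow_mul_bracket_rpow_le 1 (-s - 1) k
  have h' := abs_pow_mul_bracket_rpow_le 3 (-s - 1) k
  rw [show -s - 1 - ((1 : ℕ) : ℝ) = -s - 2 by push_cast; ring, pow_one] at h
  rw [show -s - 1 - ((3 : ℕ) : ℝ) = -s - 4 by push_cast; ring] at h'
  have h0 := Real.rpow_nonneg (bracket_pos k).le (-s - 4)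
  have h2 := Real.rpow_nonneg (bracket_pos k).le (-s - 2)
  rw [amplitudeDerivTwo]
  refine (abs_add_le _ _).trans ?_
  rw [abs_mul, abs_mul, abs_mul (s * (s + 2) * k ^ 3), abs_mul (s * (s + 2)), abs_of_nonneg h0,
    abs_of_nonneg h2, abs_pow, abs_neg, abs_of_nonneg (by positivity : 0 ≤ 3 * s),
    abs_of_nonneg (by positivity : 0 ≤ s * (s + 2)), mul_assoc (3 * s),
    mul_assoc (s * (s + 2)), add_mul]
  exact add_le_add (mul_le_mul_of_nonneg_left h (by positivity))
    (mul_le_mul_of_nonneg_left h' (by positivity))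

theorem bracket_rpow_le_rpow {a k : ℝ} (ha : a ≤ 0) (hk : 0 < k) : bracket k ^ a ≤ k ^ a :=
  Real.rpow_le_rpow_of_nonpos hk ((le_abs_self k).trans (abs_le_bracket k)) ha

theorem bracket_rpow_mono {a b : ℝ} (h : a ≤ b) (k : ℝ) : bracket k ^ a ≤ bracket k ^ b :=
  Real.rpow_le_rpow_of_exponent_le (one_le_bracket k) h

/-- The condition `1 + a ≤ s` makes `⟨k⟩^{1-s}` and `⟨k⟩^{-s}` at most `k^{-a}` and `k^{-a-1}`, as
`norm_laplace_le_rpow` requires. -/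
theorem norm_laplace_amplitude_le_rpow {s a : ℝ} (ha0 : 0 < a) (ha1 : a < 1) (has : 1 + a ≤ s)
    {z : ℂ} (hz : 0 < z.re) :
    ‖laplace (amplitude s) z‖ ≤ (1 + s) * (1 / (1 - a) + 1 + 1 / a) * ‖z‖ ^ (a - 1) := by
  refine norm_laplace_le_rpow ha0 ha1 (continuous_amplitude s) (continuous_amplitudeDeriv s)
    (hasDerivAt_amplitude s) (fun k hk => ?_) (fun k hk => ?_) hz
  · refine (abs_amplitude_le s k).trans ((bracket_rpow_mono (b := -a) (by linarith) k).trans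
      ((bracket_rpow_le_rpow (by linarith) hk).trans ?_))
    exact le_mul_of_one_le_left (Real.rpow_nonneg hk.le _) (by linarith)
  · refine (abs_amplitudeDeriv_le (by linarith) k).trans (mul_le_mul_of_nonneg_left ?_
      (by linarith))
    exact (bracket_rpow_mono (by linarith) k).trans (bracket_rpow_le_rpow (by linarith) hk)

theorem integrable_bracket_rpow {a : ℝ} (ha : 1 < a) :
    Integrable fun k : ℝ => bracket k ^ (-a) := by
  have := integrable_rpow_neg_one_add_norm_sq (E := ℝ) (μ := volume) (r := a) (by simpa using ha)
  refine this.congr (.of_forall fun k => ?_)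
  simp only [bracket]
  rw [Real.sqrt_eq_rpow, ← Real.rpow_mul (by positivity)]
  simp
  congr 1
  ring

/-- For `s > 2` the amplitude is itself integrable. -/
theorem norm_laplace_amplitude_le {s : ℝ} (hs : 2 < s) {z : ℂ} (hz : 0 < z.re) :
    ‖laplace (amplitude s) z‖ ≤ ∫ k in Ioi (0 : ℝ), bracket k ^ (-(s - 1)) := by
  refine norm_laplace_le_integral hz (integrable_bracket_rpow (by linarith)).integrableOn
    fun k _ => (abs_amplitude_le s k).trans_eq ?_
  rw [neg_sub]

/-- Two integrations by parts. The amplitude vanishes at `0` and has slope `1` there, so `z²` times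
its transform is `1` plus the transform of the integrable second derivative. -/
theorem norm_laplace_amplitude_le_inv_sq {s : ℝ} (hs : 2 < s) {z : ℂ} (hz : 0 < z.re) :
    ‖laplace (amplitude s) z‖ ≤ (1 + (3 * s + s * (s + 2)) *
      ∫ k in Ioi (0 : ℝ), bracket k ^ (-(s + 1))) * (‖z‖ ^ 2)⁻¹ := by
  have hz0 : 0 < ‖z‖ := hz.trans_le ((le_abs_self _).trans (Complex.abs_re_le_norm z))
  have hone {a : ℝ} (ha : a ≤ 0) (k : ℝ) : bracket k ^ a ≤ 1 :=
    Real.rpow_le_one_of_one_le_of_nonpos (one_le_bracket k) ha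
  have hb0 : ∀ k, 0 < k → |amplitude s k| ≤ 1 := fun k _ =>
    (abs_amplitude_le s k).trans (hone (by linarith) k)
  have hb1 : ∀ k, 0 < k → |amplitudeDeriv s k| ≤ 1 + s := fun k _ =>
    (abs_amplitudeDeriv_le (by linarith) k).trans
      (mul_le_of_le_one_right (by linarith) (hone (by linarith) k))
  have hb2 : ∀ k, 0 < k → |amplitudeDerivTwo s k| ≤ 3 * s + s * (s + 2) := fun k _ =>
    (abs_amplitudeDerivTwo_le (by linarith) k).trans
      (mul_le_of_le_one_right (by positivity) (hone (by linarith) k))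
  have h1 := mul_laplace hz (continuous_amplitude s) (continuous_amplitudeDeriv s)
    (hasDerivAt_amplitude s) hb0 hb1
  have h2 := mul_laplace hz (continuous_amplitudeDeriv s) (continuous_amplitudeDerivTwo s)
    (hasDerivAt_amplitudeDeriv s) hb1 hb2
  have hzero : amplitude s 0 = 0 := by simp [amplitude]
  have hone' : amplitudeDeriv s 0 = 1 := by simp [amplitudeDeriv, bracket]
  rw [hzero, Complex.ofReal_zero, zero_add] at h1
  rw [hone', ← h1] at h2
  have h3 : ‖laplace (amplitudeDerivTwo s) z‖ ≤ (3 * s + s * (s + 2)) *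
      ∫ k in Ioi (0 : ℝ), bracket k ^ (-(s + 1)) := by
    rw [← integral_const_mul]
    refine norm_laplace_le_integral hz
      ((integrable_bracket_rpow (by linarith)).integrableOn.const_mul _) fun k _ => ?_
    rw [neg_add']
    exact abs_amplitudeDerivTwo_le (by linarith) k
  rw [← div_eq_mul_inv, le_div_iff₀ (by positivity)]
  calc ‖laplace (amplitude s) z‖ * ‖z‖ ^ 2 = ‖z * (z * laplace (amplitude s) z)‖ := by
        rw [norm_mul, norm_mul]; ring
    _ ≤ _ := by
        rw [h2]
        refine (norm_add_le _ _).trans ?_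
        simpa using h3

/-! ### Quadratic lower bound for the phase and the angular average. -/

section Angular

open Real

theorem sq_le_sin_half_sq {x : ℝ} (hx : |x| ≤ π) : (x / π) ^ 2 ≤ sin (x / 2) ^ 2 := by
  have h := mul_le_sin (x := |x| / 2) (by positivity) (by linarith)
  have h1 : 2 / π * (|x| / 2) = |x / π| := by
    rw [abs_div, abs_of_pos pi_pos]
    field_simp
  have h2 : sin (|x| / 2) ^ 2 = sin (x / 2) ^ 2 := by
    rcases abs_choice x with h | h <;> rw [h]
    rw [neg_div, sin_neg, neg_sq]
  rw [← h2, ← sq_abs (x / π), ← h1]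
  exact pow_le_pow_left₀ (by positivity) h 2

/-- The difference of cosines is `-2 sin((θ+φ)/2) sin((θ-φ)/2)`. On `[0, π]` the first sine
dominates the second in absolute value, so the product is at least `2 sin²((θ-φ)/2)` in size. -/
theorem two_mul_sq_le_abs_cos_sub_cos {θ φ : ℝ} (hθ : θ ∈ Icc 0 π) (hφ : φ ∈ Icc 0 π) :
    2 * ((θ - φ) / π) ^ 2 ≤ |cos θ - cos φ| := by
  obtain ⟨hθ0, hθ1⟩ := hθ
  obtain ⟨hφ0, hφ1⟩ := hφ
  have h1 := sq_le_sin_half_sq (x := θ - φ) (abs_le.2 ⟨by linarith, by linarith⟩)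
  have h2 : |sin ((θ - φ) / 2)| ≤ sin ((θ + φ) / 2) := by
    have hs : 0 ≤ sin (θ / 2) := sin_nonneg_of_nonneg_of_le_pi (by linarith) (by linarith)
    have hc : 0 ≤ cos (θ / 2) := cos_nonneg_of_mem_Icc ⟨by linarith, by linarith⟩
    have hs' : 0 ≤ sin (φ / 2) := sin_nonneg_of_nonneg_of_le_pi (by linarith) (by linarith)
    have hc' : 0 ≤ cos (φ / 2) := cos_nonneg_of_mem_Icc ⟨by linarith, by linarith⟩
    rw [sub_div, add_div, sin_sub, sin_add]
    have := mul_nonneg hs hc'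
    have := mul_nonneg hc hs'
    exact abs_le.2 ⟨by linarith, by linarith⟩
  rw [cos_sub_cos, abs_mul, abs_mul, abs_neg, abs_two, abs_of_nonneg ((abs_nonneg _).trans h2),
    mul_assoc]
  refine mul_le_mul_of_nonneg_left (h1.trans ?_) zero_le_two
  rw [← sq_abs, sq]
  exact mul_le_mul_of_nonneg_right h2 (abs_nonneg _)

theorem exists_sq_le_of_pos {r t : ℝ} (hr : 0 ≤ r) (ht : 0 < t) :
    ∃ φ, ∀ θ ∈ Icc 0 π, t * ((θ - φ) / π) ^ 2 ≤ |r * cos θ - t| := by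
  rcases lt_or_ge r t with h | h
  -- If `r < t` the phase has no zero; `φ = 0` works because `t - r cos θ ≥ t (1 - cos θ)/2 = t
  -- sin²(θ/2)`.
  · refine ⟨0, fun θ hθ => ?_⟩
    have h1 := sq_le_sin_half_sq (x := θ) (abs_le.2 ⟨by linarith [hθ.1, pi_pos], hθ.2⟩)
    have h2 : sin (θ / 2) ^ 2 = 1 / 2 - cos θ / 2 := by
      rw [sin_sq_eq_half_sub]
      ring_nf
    rw [h2] at h1
    have h3 : r * cos θ - t ≤ -(t * (1 / 2 - cos θ / 2)) := by
      rcases le_total 0 (cos θ) with hc | hc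
      · nlinarith [cos_le_one θ]
      · nlinarith [neg_one_le_cos θ]
    rw [sub_zero]
    exact (mul_le_mul_of_nonneg_left h1 ht.le).trans ((le_neg.2 h3).trans (neg_le_abs _))
  · have hr0 : 0 < r := ht.trans_le h
    -- Here `φ` is the zero of the phase, and `r ≥ t` turns the factor `r` into `t`.
    refine ⟨arccos (t / r), fun θ hθ => ?_⟩
    have h1 := two_mul_sq_le_abs_cos_sub_cos hθ ⟨arccos_nonneg (t / r), arccos_le_pi (t / r)⟩
    have hdiv : t / r ≤ 1 := (div_le_one hr0).2 h
    rw [cos_arccos (by linarith [div_pos ht hr0]) hdiv] at h1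
    have h2 : |r * cos θ - t| = r * |cos θ - t / r| := by
      rw [← abs_of_pos hr0, ← abs_mul, abs_of_pos hr0, mul_sub, mul_div_cancel₀ _ hr0.ne']
    rw [h2]
    have := sq_nonneg ((θ - arccos (t / r)) / π)
    nlinarith

/-- The phase `r cos θ - t` vanishes at most quadratically in the angle, at rate `|t|`. -/
theorem exists_sq_le_abs_mul_cos_sub {r t : ℝ} (hr : 0 ≤ r) (ht : t ≠ 0) :
    ∃ φ, ∀ θ ∈ Icc (-π) π, |t| * ((|θ| - φ) / π) ^ 2 ≤ |r * cos θ - t| := by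
  have key : ∃ φ, ∀ θ ∈ Icc 0 π, |t| * ((θ - φ) / π) ^ 2 ≤ |r * cos θ - t| := by
    rcases ht.lt_or_gt with h | h
    · obtain ⟨φ, hφ⟩ := exists_sq_le_of_pos hr (neg_pos.2 h)
      refine ⟨π - φ, fun θ hθ => ?_⟩
      -- Reflecting `θ ↦ π - θ` changes the sign of the cosine and reduces negative `t` to positive
      -- `t`.
      have := hφ (π - θ) ⟨by linarith [hθ.2], by linarith [hθ.1]⟩
      rw [cos_pi_sub] at this
      rw [abs_of_neg h, ← abs_neg, show -(r * cos θ - t) = r * -cos θ - -t by ring,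
        show (θ - (π - φ)) / π = -((π - θ - φ) / π) by ring, neg_sq]
      exact this
    · rw [abs_of_pos h]
      exact exists_sq_le_of_pos hr h
  obtain ⟨φ, hφ⟩ := key
  refine ⟨φ, fun θ hθ => ?_⟩
  have := hφ |θ| ⟨abs_nonneg θ, abs_le.2 hθ⟩
  rwa [cos_abs] at this

/-- An integrable majorant on the line, `min (|v|^{-1+2e}, |v|^{-1-2e})`. -/
def majorant (e v : ℝ) : ℝ := min (|v| ^ (-1 + 2 * e)) (|v| ^ (-1 - 2 * e))

theorem majorant_nonneg (e v : ℝ) : 0 ≤ majorant e v :=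
  le_min (rpow_nonneg (abs_nonneg _) _) (rpow_nonneg (abs_nonneg _) _)

theorem integrable_majorant {e : ℝ} (he : 0 < e) : Integrable (majorant e) := by
  have hmeas : Measurable fun y : ℝ => min (y ^ (-1 + 2 * e)) (y ^ (-1 - 2 * e)) := by fun_prop
  have h := (integrable_fun_norm_addHaar (volume : Measure ℝ)
    (f := fun y => min (y ^ (-1 + 2 * e)) (y ^ (-1 - 2 * e)))).2
  refine h ?_
  simp only [Module.finrank_self, tsub_self, pow_zero, one_smul]
  rw [← Ioc_union_Ioi_eq_Ioi zero_le_one]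
  refine IntegrableOn.union ?_ ?_
  · have h1 : IntegrableOn (fun y : ℝ => y ^ (-1 + 2 * e)) (Ioc 0 1) :=
      (intervalIntegrable_iff_integrableOn_Ioc_of_le zero_le_one).1
        (intervalIntegral.intervalIntegrable_rpow' (by linarith))
    refine h1.mono' hmeas.aestronglyMeasurable ?_
    filter_upwards [self_mem_ae_restrict measurableSet_Ioc] with y hy
    rw [norm_of_nonneg (le_min (rpow_nonneg hy.1.le _) (rpow_nonneg hy.1.le _))]
    exact min_le_left _ _
  · have h1 : IntegrableOn (fun y : ℝ => y ^ (-1 - 2 * e)) (Ioi 1) :=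
      integrableOn_Ioi_rpow_of_lt (by linarith) one_pos
    refine h1.mono' hmeas.aestronglyMeasurable ?_
    filter_upwards [self_mem_ae_restrict measurableSet_Ioi] with y hy
    have hy0 : (0 : ℝ) ≤ y := zero_le_one.trans (le_of_lt hy)
    rw [norm_of_nonneg (le_min (rpow_nonneg hy0 _) (rpow_nonneg hy0 _))]
    exact min_le_right _ _

/-- Since `e < 1/2`, both powers have negative exponents, so `|s|` may be replaced by its lower
bound `v²`, which doubles the exponents. -/
theorem le_majorant {E : Type*} [NormedAddCommGroup E] {f : ℝ → E} {C e : ℝ} (hC : 0 ≤ C)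
    (he : 0 < e) (he' : e < 1 / 2)
    (h1 : ∀ s, s ≠ 0 → ‖f s‖ ≤ C * |s| ^ (-(1 / 2) + e))
    (h2 : ∀ s, s ≠ 0 → ‖f s‖ ≤ C * |s| ^ (-(1 / 2) - e)) {s v : ℝ} (hv : v ≠ 0)
    (hvs : v ^ 2 ≤ |s|) : ‖f s‖ ≤ C * majorant e v := by
  have hv2 : 0 < v ^ 2 := by positivity
  have hs : s ≠ 0 := abs_pos.1 (hv2.trans_le hvs)
  have hpow (a : ℝ) (ha : a ≤ 0) : |s| ^ a ≤ |v| ^ (2 * a) := by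
    refine (rpow_le_rpow_of_nonpos hv2 hvs ha).trans_eq ?_
    rw [← sq_abs, ← rpow_two, ← rpow_mul (abs_nonneg v)]
  rw [majorant, mul_min_of_nonneg _ _ hC]
  refine le_min ((h1 s hs).trans (mul_le_mul_of_nonneg_left ?_ hC))
    ((h2 s hs).trans (mul_le_mul_of_nonneg_left ?_ hC))
  · refine (hpow _ (by linarith)).trans_eq ?_
    ring_nf
  · refine (hpow _ (by linarith)).trans_eq ?_
    ring_nf

/-- The angular average of a function with `|f s| ≤ C min (|s|^{-1/2+e}, |s|^{-1/2-e})` along the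
phase `r cos θ - t` is `O(|t|^{-1/2})`, uniformly in `r`. -/
theorem integral_norm_comp_cos_le {E : Type*} [NormedAddCommGroup E] {f : ℝ → E} {C e : ℝ}
    (hC : 0 ≤ C) (he : 0 < e) (he' : e < 1 / 2)
    (h1 : ∀ s, s ≠ 0 → ‖f s‖ ≤ C * |s| ^ (-(1 / 2) + e))
    (h2 : ∀ s, s ≠ 0 → ‖f s‖ ≤ C * |s| ^ (-(1 / 2) - e)) {r t : ℝ} (hr : 0 ≤ r) (ht : t ≠ 0) :
    ∫ θ in (-π)..π, ‖f (r * cos θ - t)‖ ≤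
      (2 * π * C * ∫ v, majorant e v) * |t| ^ (-(1 / 2) : ℝ) := by
  obtain ⟨φ, hφ⟩ := exists_sq_le_abs_mul_cos_sub hr ht
  have ht0 : 0 < |t| := abs_pos.2 ht
  -- Chosen so that `(κ (|θ| - φ))²` is exactly the quadratic lower bound of the phase.
  set κ : ℝ := √|t| / π with hκ
  have hκ0 : 0 < κ := by positivity
  have hint0 : Integrable fun θ => majorant e (κ * θ) :=
    (integrable_majorant he).comp_mul_left' hκ0.ne'
  have hint1 : Integrable fun θ => majorant e (κ * (θ - φ)) := hint0.comp_sub_right φ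
  have hint2 : Integrable fun θ => majorant e (κ * (θ + φ)) := hint0.comp_add_right φ
  have hint : Integrable fun θ => C * (majorant e (κ * (θ - φ)) + majorant e (κ * (θ + φ))) :=
    (hint1.add hint2).const_mul C
  have hbound : ∀ᵐ θ ∂(volume.restrict (Ioc (-π) π)), ‖‖f (r * cos θ - t)‖‖ ≤
      C * (majorant e (κ * (θ - φ)) + majorant e (κ * (θ + φ))) := by
    -- The two possible zeros `± φ` are discarded: at `v = 0` the majorant takes the value `0` by
    -- the convention for real powers and bounds nothing.
    have hne : ∀ᵐ θ ∂(volume.restrict (Ioc (-π) π)), θ ∉ ({φ, -φ} : Set ℝ) :=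
      ae_restrict_of_ae (measure_eq_zero_iff_ae_notMem.1 ((Set.toFinite _).measure_zero _))
    filter_upwards [self_mem_ae_restrict measurableSet_Ioc, hne] with θ hθ hθφ
    simp only [mem_insert_iff, mem_singleton_iff, not_or] at hθφ
    rw [norm_norm]
    have hsq : (κ * (|θ| - φ)) ^ 2 ≤ |r * cos θ - t| := by
      refine le_trans (le_of_eq ?_) (hφ θ ⟨hθ.1.le, hθ.2⟩)
      rw [hκ, mul_pow, div_pow, div_pow, sq_sqrt ht0.le]
      ring
    have hne' : κ * (|θ| - φ) ≠ 0 := by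
      refine mul_ne_zero hκ0.ne' (sub_ne_zero.2 fun h => ?_)
      rcases abs_choice θ with h' | h' <;> rw [h'] at h
      · exact hθφ.1 h
      · exact hθφ.2 (by linarith)
    refine (le_majorant hC he he' h1 h2 hne' hsq).trans (mul_le_mul_of_nonneg_left ?_ hC)
    -- According to the sign of `θ`, one of the two translates is the required majorant and the
    -- other is nonnegative.
    rcases abs_choice θ with h' | h' <;> rw [h']
    · exact le_add_of_nonneg_right (majorant_nonneg _ _)
    · refine le_trans (le_of_eq ?_) (le_add_of_nonneg_left (majorant_nonneg _ _))
      rw [show κ * (-θ - φ) = -(κ * (θ + φ)) by ring, majorant, majorant, abs_neg]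
  rw [intervalIntegral.integral_of_le (by linarith [pi_pos])]
  refine (le_abs_self _).trans ((norm_integral_le_of_norm_le hint.integrableOn hbound).trans ?_)
  refine (setIntegral_le_integral hint (.of_forall fun θ =>
    mul_nonneg hC (add_nonneg (majorant_nonneg _ _) (majorant_nonneg _ _)))).trans_eq ?_
  rw [integral_const_mul, integral_add hint1 hint2,
    integral_sub_right_eq_self (fun θ => majorant e (κ * θ)) φ,
    integral_add_right_eq_self (fun θ => majorant e (κ * θ)) φ,
    Measure.integral_comp_mul_left, abs_of_pos (inv_pos.2 hκ0), smul_eq_mul, hκ, inv_div,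
    rpow_neg ht0.le, ← sqrt_eq_rpow]
  ring

end Angular

/-! ### The kernel in polar coordinates. -/

/-- The point of the plane with polar coordinates `(ρ, θ)`. -/
def polarPoint (ρ θ : ℝ) : Plane := !₂[ρ * Real.cos θ, ρ * Real.sin θ]

theorem integral_eq_integral_polarPoint {E : Type*} [NormedAddCommGroup E] [NormedSpace ℝ E]
    (g : Plane → E) :
    ∫ ξ, g ξ = ∫ p in Ioi (0 : ℝ) ×ˢ Ioo (-Real.pi) Real.pi, p.1 • g (polarPoint p.1 p.2) := by
  have h1 := (EuclideanSpace.volume_preserving_symm_measurableEquiv_toLp (Fin 2)).symm.integral_comp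
    (MeasurableEquiv.measurableEmbedding _) g
  have h2 := (volume_preserving_finTwoArrow ℝ).symm.integral_comp
    (MeasurableEquiv.measurableEmbedding _) (fun x : Fin 2 → ℝ => g (WithLp.toLp 2 x))
  rw [← h1]
  refine Eq.trans h2.symm ?_
  rw [← integral_comp_polarCoord_symm]
  rfl

theorem norm_polarPoint (ρ θ : ℝ) : ‖polarPoint ρ θ‖ = |ρ| := by
  rw [EuclideanSpace.norm_eq, Fin.sum_univ_two]
  simp only [polarPoint, PiLp.toLp_apply, Matrix.cons_val_zero, Matrix.cons_val_one,
    Real.norm_eq_abs, sq_abs]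
  rw [mul_pow, mul_pow, ← mul_add, Real.cos_sq_add_sin_sq, mul_one, Real.sqrt_sq_eq_abs]

theorem exists_eq_polarPoint (x : Plane) : ∃ α, x = polarPoint ‖x‖ α := by
  refine ⟨Complex.arg (x 0 + x 1 * Complex.I), ?_⟩
  have hn : ‖(x 0 + x 1 * Complex.I : ℂ)‖ = ‖x‖ := by
    rw [EuclideanSpace.norm_eq, Fin.sum_univ_two, Complex.norm_add_mul_I]
    simp
  ext i
  fin_cases i
  · simp [polarPoint, ← hn, Complex.norm_mul_cos_arg]
  · simp [polarPoint, ← hn, Complex.norm_mul_sin_arg]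

theorem inner_polarPoint (ρ θ r α : ℝ) :
    inner ℝ (polarPoint ρ θ) (polarPoint r α) = ρ * (r * Real.cos (θ - α)) := by
  rw [EuclideanSpace.inner_eq_star_dotProduct]
  simp [polarPoint, dotProduct, Fin.sum_univ_two, Real.cos_sub]
  ring

theorem diracSymbol_polarPoint (ρ θ : ℝ) :
    diracSymbol (polarPoint ρ θ) = (ρ : ℂ) • diracSymbol (polarPoint 1 θ) := by
  simp only [diracSymbol, map_add, map_smul, polarPoint, PiLp.toLp_apply, Matrix.cons_val_zero,
    Matrix.cons_val_one, smul_add, smul_smul]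
  congr 2 <;> push_cast <;> ring

theorem norm_diracSymbol_le (ξ : Plane) : ‖diracSymbol ξ‖ ≤ 2 * Real.pi * ‖ξ‖ := by
  have h := norm_cfc_le (a := diracSymbol ξ) (f := fun z : ℂ => z) (c := 2 * Real.pi * ‖ξ‖)
    (by positivity) fun z hz => by
      rcases spectrum_diracSymbol ξ hz with rfl | rfl
      · rw [Complex.norm_real, Real.norm_of_nonneg (by positivity)]
      · rw [norm_neg, Complex.norm_real, Real.norm_of_nonneg (by positivity)]
  have hn : IsStarNormal (diracSymbol ξ) := (isSelfAdjoint_diracSymbol ξ).isStarNormal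
  rwa [cfc_id' ℂ (diracSymbol ξ)] at h

/-- The spectral projection of the symbol in the direction `θ` on the positive (`σ = 1`) or the
negative (`σ = -1`) eigenvalue. -/
def spectralProj (σ : ℂ) (θ : ℝ) : Spinor →L[ℂ] Spinor :=
  (1 / 2 : ℂ) • ((1 : Spinor →L[ℂ] Spinor) + (σ / (2 * Real.pi)) • diracSymbol (polarPoint 1 θ))

theorem norm_spectralProj_le {σ : ℂ} (hσ : ‖σ‖ = 1) (θ : ℝ) : ‖spectralProj σ θ‖ ≤ 1 := by
  have h1 : ‖(σ / (2 * Real.pi)) • diracSymbol (polarPoint 1 θ)‖ ≤ 1 := by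
    have h2 := norm_diracSymbol_le (polarPoint 1 θ)
    rw [norm_polarPoint, abs_one, mul_one] at h2
    have h3 : ‖σ / (2 * Real.pi)‖ = (2 * Real.pi)⁻¹ := by
      rw [norm_div, hσ, norm_mul, Complex.norm_real, Real.norm_of_nonneg Real.pi_pos.le]
      simp
    rw [norm_smul, h3, inv_mul_le_iff₀ (by positivity), mul_one]
    exact h2
  rw [spectralProj, norm_smul]
  have h4 : ‖(1 : Spinor →L[ℂ] Spinor)‖ ≤ 1 := ContinuousLinearMap.norm_id_le
  have h5 := norm_add_le (1 : Spinor →L[ℂ] Spinor)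
    ((σ / (2 * Real.pi)) • diracSymbol (polarPoint 1 θ))
  norm_num
  linarith

theorem continuous_spectralProj (σ : ℂ) : Continuous (spectralProj σ) := by
  have h : Continuous fun θ => diracSymbol (polarPoint 1 θ) := by
    refine continuous_diracSymbol.comp ?_
    unfold polarPoint
    fun_prop
  unfold spectralProj
  fun_prop

/-- The symbol is linear in `ρ`, so its eigenprojections depend on the angle alone. This separates
the radial integral from the matrix. -/
theorem calculusSymbol_polarPoint (φ : ℝ → ℂ) {ρ : ℝ} (hρ : 0 < ρ) (θ : ℝ) :
    calculusSymbol φ (polarPoint ρ θ) = φ (2 * Real.pi * ρ) • spectralProj 1 θ +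
      φ (-(2 * Real.pi * ρ)) • spectralProj (-1) θ := by
  rw [calculusSymbol_eq, diracSymbol_polarPoint, norm_polarPoint, abs_of_pos hρ]
  have hρ' : (ρ : ℂ) ≠ 0 := by exact_mod_cast hρ.ne'
  have hπ : (Real.pi : ℂ) ≠ 0 := by exact_mod_cast Real.pi_ne_zero
  simp only [spectralProj, smul_add, smul_smul]
  generalize diracSymbol (polarPoint 1 θ) = A
  generalize φ (2 * Real.pi * ρ) = a
  generalize φ (-(2 * Real.pi * ρ)) = b
  push_cast
  match_scalars <;> field_simp
  ring

/-- The radial Fourier integral of a function along a half-line. -/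
def radialIntegral (φ : ℝ → ℂ) (u : ℝ) : ℂ :=
  ∫ ρ in Ioi (0 : ℝ), (ρ : ℂ) * ((Real.fourierChar (ρ * u) : ℂ) * φ (2 * Real.pi * ρ))

section Damped

variable {φ : ℝ →ᵇ ℂ} {b : ℝ}

theorem integrableOn_mul_exp_neg_mul (hb : 0 < b) :
    IntegrableOn (fun ρ : ℝ => ρ * Real.exp (-b * ρ)) (Ioi 0) := by
  have := integrableOn_rpow_mul_exp_neg_mul_rpow (s := 1) (p := 1) (by norm_num) one_pos hb
  simpa using this

/-- The matrix norm is controlled by `φ` at `± 2π|ξ|`, which decays exponentially. -/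
theorem integrable_calculusSymbol (hb : 0 < b) (hφ : ∀ r, ‖φ r‖ ≤ Real.exp (-b * |r|)) :
    Integrable (calculusSymbol φ) := by
  have hb' : 0 < b * (2 * Real.pi) := by positivity
  have h1 : Integrable fun ξ : Plane => Real.exp (-(b * (2 * Real.pi)) * ‖ξ‖) := by
    refine (integrable_fun_norm_addHaar (volume : Measure Plane)
      (f := fun y => Real.exp (-(b * (2 * Real.pi)) * y))).2 ?_
    simpa using integrableOn_mul_exp_neg_mul hb'
  refine h1.mono' (memLp_calculusSymbol φ).aestronglyMeasurable (.of_forall fun ξ => ?_)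
  refine norm_calculusSymbol_le (Real.exp_pos _).le ξ fun r hr => (hφ r).trans_eq ?_
  rw [hr]
  ring_nf

/-- The kernel of `φ(D₀)` in polar coordinates: it is bounded by the angular integral of radial
Fourier integrals. -/
theorem norm_fourierInv_calculusSymbol_le (hb : 0 < b) (hφ : ∀ r, ‖φ r‖ ≤ Real.exp (-b * |r|))
    (x : Plane) :
    ‖𝓕⁻ (calculusSymbol φ) x‖ ≤
      (∫ θ in (-Real.pi)..Real.pi, ‖radialIntegral φ (‖x‖ * Real.cos θ)‖) +
        ∫ θ in (-Real.pi)..Real.pi, ‖radialIntegral (fun r => φ (-r)) (‖x‖ * Real.cos θ)‖ := by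
  obtain ⟨α, hα⟩ := exists_eq_polarPoint x
  set r := ‖x‖ with hr
  have hπ := Real.pi_pos
  set W : ℝ × ℝ → Spinor →L[ℂ] Spinor := fun p =>
    ((p.1 : ℂ) * ((Real.fourierChar (p.1 * (r * Real.cos (p.2 - α))) : ℂ) *
      φ (2 * Real.pi * p.1))) • spectralProj 1 p.2 +
    ((p.1 : ℂ) * ((Real.fourierChar (p.1 * (r * Real.cos (p.2 - α))) : ℂ) *
      φ (-(2 * Real.pi * p.1)))) • spectralProj (-1) p.2 with hW
  have hK : 𝓕⁻ (calculusSymbol φ) x = ∫ p in Ioi (0 : ℝ) ×ˢ Ioo (-Real.pi) Real.pi, W p := by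
    rw [Real.fourierInv_eq, integral_eq_integral_polarPoint]
    refine setIntegral_congr_fun (measurableSet_Ioi.prod measurableSet_Ioo) fun p hp => ?_
    simp only [hW]
    rw [calculusSymbol_polarPoint _ hp.1, hα, inner_polarPoint]
    simp only [Circle.smul_def, smul_add, smul_smul, ← Complex.coe_smul]
  have hexp (s : ℝ) (hs : |s| = 1) : ∀ ρ, 0 < ρ → ‖φ (s * (2 * Real.pi * ρ))‖ ≤
      Real.exp (-(b * (2 * Real.pi)) * ρ) := fun ρ hρ => (hφ _).trans_eq (by
    rw [abs_mul, hs, one_mul, abs_of_pos (by positivity)]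
    ring_nf)
  have hcoef (s u ρ : ℝ) (hs : |s| = 1) (hρ : 0 < ρ) :
      ‖(ρ : ℂ) * ((Real.fourierChar (ρ * u) : ℂ) * φ (s * (2 * Real.pi * ρ)))‖ ≤
        ρ * Real.exp (-(b * (2 * Real.pi)) * ρ) := by
    rw [norm_mul, norm_mul, Circle.norm_coe, one_mul, Complex.norm_real, Real.norm_of_nonneg hρ.le]
    exact mul_le_mul_of_nonneg_left (hexp s hs ρ hρ) hρ.le
  have hexpint := integrableOn_mul_exp_neg_mul (b := b * (2 * Real.pi)) (by positivity)
  have hchar : Continuous fun p : ℝ × ℝ =>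
      (Real.fourierChar (p.1 * (r * Real.cos (p.2 - α))) : ℂ) := by fun_prop
  have hP (σ : ℂ) : Continuous fun p : ℝ × ℝ => spectralProj σ p.2 :=
    (continuous_spectralProj σ).comp continuous_snd
  have hWint : Integrable W ((volume.restrict (Ioi 0)).prod
      (volume.restrict (Ioo (-Real.pi) Real.pi))) := by
    have hc : Integrable (fun _ : ℝ => (2 : ℝ)) (volume.restrict (Ioo (-Real.pi) Real.pi)) :=
      integrable_const _
    refine (Integrable.mul_prod hexpint hc).mono' ?_ ?_
    · refine Continuous.aestronglyMeasurable ?_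
      have := hP 1
      have := hP (-1)
      fun_prop
    · rw [Measure.prod_restrict]
      filter_upwards [self_mem_ae_restrict (measurableSet_Ioi.prod measurableSet_Ioo)] with p hp
      have h1 := hcoef 1 (r * Real.cos (p.2 - α)) p.1 abs_one hp.1
      have h2 := hcoef (-1) (r * Real.cos (p.2 - α)) p.1 (by simp) hp.1
      rw [one_mul] at h1
      rw [neg_one_mul] at h2
      refine (norm_add_le _ _).trans ?_
      rw [norm_smul, norm_smul, mul_two]
      exact add_le_add
        ((mul_le_of_le_one_right (norm_nonneg _) (norm_spectralProj_le (by simp) _)).trans h1)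
        ((mul_le_of_le_one_right (norm_nonneg _) (norm_spectralProj_le (by simp) _)).trans h2)
  have hradial (s u : ℝ) (hs : |s| = 1) : IntegrableOn (fun ρ : ℝ =>
      (ρ : ℂ) * ((Real.fourierChar (ρ * u) : ℂ) * φ (s * (2 * Real.pi * ρ)))) (Ioi 0) := by
    refine hexpint.mono' (Continuous.aestronglyMeasurable (by fun_prop)) ?_
    filter_upwards [self_mem_ae_restrict measurableSet_Ioi] with ρ hρ
    exact hcoef s u ρ hs hρ
  set G : ℝ → ℝ := fun θ => ‖radialIntegral φ (r * Real.cos θ)‖ +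
    ‖radialIntegral (fun r => φ (-r)) (r * Real.cos θ)‖ with hG
  -- The projections are constant in `ρ` and have norm at most `1`, so they drop out of the radial
  -- integral.
  have hinner (θ : ℝ) : ‖∫ ρ in Ioi (0 : ℝ), W (ρ, θ)‖ ≤ G (θ - α) := by
    have h1 := hradial 1 (r * Real.cos (θ - α)) abs_one
    have h2 := hradial (-1) (r * Real.cos (θ - α)) (by simp)
    simp only [one_mul] at h1
    simp only [neg_one_mul] at h2
    simp only [hW]
    rw [integral_add (h1.smul_const _) (h2.smul_const _), integral_smul_const, integral_smul_const]
    refine (norm_add_le _ _).trans ?_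
    rw [norm_smul, norm_smul]
    exact add_le_add (mul_le_of_le_one_right (norm_nonneg _) (norm_spectralProj_le (by simp) _))
      (mul_le_of_le_one_right (norm_nonneg _) (norm_spectralProj_le (by simp) _))
  have hcont (ψ : ℝ → ℂ) (s : ℝ) (hs : |s| = 1) (hψ : ∀ r, ψ r = φ (s * r)) :
      Continuous (radialIntegral ψ) := by
    unfold radialIntegral
    simp only [hψ]
    refine continuous_of_dominated (fun u => (hradial s u hs).aestronglyMeasurable)
      (fun u => ?_) hexpint (.of_forall fun ρ => by fun_prop)
    filter_upwards [self_mem_ae_restrict measurableSet_Ioi] with ρ hρ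
    exact hcoef s u ρ hs hρ
  have hG1 : Continuous fun θ => ‖radialIntegral φ (r * Real.cos θ)‖ := by
    have := hcont φ 1 abs_one (by simp)
    fun_prop
  have hG2 : Continuous fun θ => ‖radialIntegral (fun r => φ (-r)) (r * Real.cos θ)‖ := by
    have := hcont (fun r => φ (-r)) (-1) (by simp) (by simp)
    fun_prop
  have hGcont : Continuous G := hG1.add hG2
  have hper : Function.Periodic G (2 * Real.pi) := fun θ => by
    simp only [hG, Real.cos_add_two_pi]
  have hGint : IntegrableOn (fun θ => G (θ - α)) (Ioo (-Real.pi) Real.pi) := by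
    have : Continuous fun θ => G (θ - α) := by fun_prop
    exact (this.integrableOn_Icc).mono_set Ioo_subset_Icc_self
  rw [hK, Measure.volume_eq_prod, ← Measure.prod_restrict, integral_prod_symm W hWint]
  refine (norm_integral_le_of_norm_le hGint (.of_forall hinner)).trans_eq ?_
  rw [← integral_Ioc_eq_integral_Ioo, ← intervalIntegral.integral_of_le (by linarith),
    intervalIntegral.integral_comp_sub_right (fun θ => G θ)]
  -- The direction `α` of `x` only shifts the angular interval, and periodicity shifts it back.
  have h3 := hper.intervalIntegral_add_eq (-Real.pi - α) (-Real.pi)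
  rw [show -Real.pi - α + 2 * Real.pi = Real.pi - α by ring,
    show -Real.pi + 2 * Real.pi = Real.pi by ring] at h3
  rw [h3]
  exact intervalIntegral.integral_add (hG1.intervalIntegrable _ _) (hG2.intervalIntegrable _ _)

end Damped

/-! ### Exponential damping and its removal. -/

/-- The function `λ ↦ exp (-δ |λ|)`, for `δ ≥ 0`. -/
def damping (δ : ℝ≥0) : ℝ →ᵇ ℂ :=
  BoundedContinuousFunction.ofNormedAddCommGroup
    (fun r : ℝ => ((Real.exp (-(δ : ℝ) * |r|) : ℝ) : ℂ)) (by fun_prop) 1 fun r => by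
      rw [Complex.norm_real, Real.norm_of_nonneg (Real.exp_pos _).le, Real.exp_le_one_iff]
      have := mul_nonneg δ.2 (abs_nonneg r)
      simp only [neg_mul, Left.neg_nonpos_iff]
      exact this

/-- The function `λ ↦ exp (-i t λ) ⟨λ⟩^{-s} exp (-δ |λ|)`. -/
def dampedEvolution (t : ℝ) (s δ : ℝ≥0) : ℝ →ᵇ ℂ := phase t * decay s * damping δ

theorem dampedEvolution_apply (t : ℝ) (s δ : ℝ≥0) (r : ℝ) :
    dampedEvolution t s δ r = Complex.exp (-Complex.I * t * r) *
      ((bracket r ^ (-(s : ℝ)) : ℝ) : ℂ) * ((Real.exp (-(δ : ℝ) * |r|) : ℝ) : ℂ) := rfl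

theorem norm_dampedEvolution_le (t : ℝ) (s δ : ℝ≥0) (r : ℝ) :
    ‖dampedEvolution t s δ r‖ ≤ Real.exp (-(δ : ℝ) * |r|) := by
  rw [dampedEvolution_apply, norm_mul, Complex.norm_real (Real.exp _),
    Real.norm_of_nonneg (Real.exp_pos _).le]
  refine mul_le_of_le_one_left (Real.exp_pos _).le ?_
  rw [norm_mul]
  refine mul_le_one₀ (le_of_eq ?_) (norm_nonneg _) (norm_bracket_rpow_le s r)
  rw [Complex.norm_exp]
  simp

theorem tendsto_dampedEvolution (t : ℝ) (s : ℝ≥0) (r : ℝ) :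
    Tendsto (fun n : ℕ => dampedEvolution t s (1 / ((n : ℝ≥0) + 1)) r) atTop
      (𝓝 ((phase t * decay s) r)) := by
  have h0 : Tendsto (fun n : ℕ => ((1 / ((n : ℝ≥0) + 1) : ℝ≥0) : ℝ)) atTop (𝓝 0) := by
    simpa using tendsto_one_div_add_atTop_nhds_zero_nat (𝕜 := ℝ)
  have h1 : Continuous fun d : ℝ => ((Real.exp (-d * |r|) : ℝ) : ℂ) := by fun_prop
  have h2 := ((h1.tendsto 0).comp h0).const_mul ((phase t * decay s) r)
  rw [neg_zero, zero_mul, Real.exp_zero, Complex.ofReal_one, mul_one] at h2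
  exact h2

/-- It suffices to bound the weighted kernels of the damped evolutions uniformly. -/
theorem normL1Linfty_weighted_evolution_le (t : ℝ) (s γ : ℝ≥0) {B : ℝ≥0}
    (hB : ∀ δ : ℝ≥0, 0 < δ → ∀ x y : Plane, bracket ‖x‖ ^ (-(γ : ℝ)) *
      ‖𝓕⁻ (calculusSymbol (dampedEvolution t s δ)) (x - y)‖ * bracket ‖y‖ ^ (-(γ : ℝ)) ≤ B) :
    normL1Linfty (weight γ ∘L evolution t ∘L smoothing s ∘L weight γ) ≤ B := by
  have hop : weight γ ∘L evolution t ∘L smoothing s ∘L weight γ =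
      weight γ ∘L functionOfDirac (phase t * decay s) ∘L weight γ := by
    rw [functionOfDirac_mul]
    rfl
  rw [hop]
  refine normL1Linfty_le_of_tendsto (S := fun n : ℕ =>
    weight γ ∘L functionOfDirac (dampedEvolution t s (1 / ((n : ℝ≥0) + 1))) ∘L weight γ)
    (fun f => ?_) fun n => ?_
  · refine ((weight γ).continuous.tendsto _).comp (tendsto_functionOfDirac zero_le_one
      (fun n r => (norm_dampedEvolution_le t s _ r).trans (Real.exp_le_one_iff.2 ?_))
      (tendsto_dampedEvolution t s) (weight γ f))
    have := mul_nonneg (1 / ((n : ℝ≥0) + 1) : ℝ≥0).2 (abs_nonneg r)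
    rw [neg_mul]
    exact neg_nonpos.2 this
  · have hδ : 0 < 1 / ((n : ℝ≥0) + 1) := by positivity
    exact normL1Linfty_weighted_le _ (integrable_calculusSymbol (NNReal.coe_pos.2 hδ)
      (norm_dampedEvolution_le t s _)) γ (hB _ hδ)

/-- The substitution `k = 2πρ`; one factor `1/(2π)` comes from `dρ`, the other from the Jacobian
`ρ`. The character, the phase and the damping merge into `e^{-zk}` with `z = δ - i(u - τ)`. -/
theorem radialIntegral_eq_laplace {φ : ℝ → ℂ} {τ s δ : ℝ}
    (hφ : ∀ k, 0 < k → φ k = Complex.exp (-Complex.I * τ * k) *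
      ((bracket k ^ (-s) : ℝ) : ℂ) * ((Real.exp (-δ * k) : ℝ) : ℂ)) (u : ℝ) :
    radialIntegral φ u = (((2 * Real.pi) ^ 2 : ℝ) : ℂ)⁻¹ *
      laplace (amplitude s) (δ - Complex.I * ((u - τ : ℝ) : ℂ)) := by
  have hπ : (0 : ℝ) < 2 * Real.pi := by positivity
  have hπ' : (Real.pi : ℂ) ≠ 0 := by exact_mod_cast Real.pi_ne_zero
  have h := integral_comp_mul_left_Ioi (fun k : ℝ =>
    Complex.exp (-(δ - Complex.I * ((u - τ : ℝ) : ℂ)) * k) * amplitude s k) 0 hπ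
  rw [mul_zero] at h
  have h2 : radialIntegral φ u = ((2 * Real.pi : ℝ) : ℂ)⁻¹ * ∫ ρ in Ioi (0 : ℝ),
      Complex.exp (-(δ - Complex.I * ((u - τ : ℝ) : ℂ)) * ((2 * Real.pi * ρ : ℝ) : ℂ)) *
        amplitude s (2 * Real.pi * ρ) := by
    rw [radialIntegral, ← integral_const_mul]
    refine setIntegral_congr_fun measurableSet_Ioi fun ρ hρ => ?_
    have hρ0 : 0 < 2 * Real.pi * ρ := mul_pos hπ hρ
    simp only [hφ _ hρ0, amplitude, Real.fourierChar_apply]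
    have hexp : Complex.exp (-(δ - Complex.I * ((u - τ : ℝ) : ℂ)) * ((2 * Real.pi * ρ : ℝ) : ℂ)) =
        Complex.exp (((2 * Real.pi * (ρ * u) : ℝ) : ℂ) * Complex.I) *
        Complex.exp (-Complex.I * τ * ((2 * Real.pi * ρ : ℝ) : ℂ)) *
        Complex.exp ((-δ * (2 * Real.pi * ρ) : ℝ) : ℂ) := by
      rw [← Complex.exp_add, ← Complex.exp_add]
      congr 1
      push_cast
      ring
    rw [hexp, Complex.ofReal_mul (2 * Real.pi * ρ), Complex.ofReal_exp]
    push_cast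
    field_simp
  rw [h2, h, laplace, Complex.real_smul, ← mul_assoc]
  push_cast
  congr 1
  field_simp

/-- The profile of the kernel of the damped evolution in the variable `x·ω ∓ t`. -/
def radialProfile (s δ u : ℝ) : ℂ :=
  (((2 * Real.pi) ^ 2 : ℝ) : ℂ)⁻¹ * laplace (amplitude s) (δ - Complex.I * (u : ℂ))

theorem norm_radialProfile_le (s δ u : ℝ) :
    ‖radialProfile s δ u‖ ≤ ‖laplace (amplitude s) (δ - Complex.I * (u : ℂ))‖ := by
  rw [radialProfile, norm_mul]
  refine mul_le_of_le_one_left (norm_nonneg _) ?_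
  rw [norm_inv, Complex.norm_real, Real.norm_of_nonneg (by positivity)]
  refine inv_le_one_of_one_le₀ ?_
  nlinarith [Real.pi_gt_three]

/-- The negative eigenvalue reverses time and otherwise gives the same profile, because the bracket
and the damping are even. -/
theorem norm_fourierInv_dampedEvolution_le (t : ℝ) (s : ℝ≥0) {δ : ℝ≥0} (hδ : 0 < δ) (x : Plane) :
    ‖𝓕⁻ (calculusSymbol (dampedEvolution t s δ)) x‖ ≤
      (∫ θ in (-Real.pi)..Real.pi, ‖radialProfile s δ (‖x‖ * Real.cos θ - t)‖) +
        ∫ θ in (-Real.pi)..Real.pi, ‖radialProfile s δ (‖x‖ * Real.cos θ - -t)‖ := by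
  have h := norm_fourierInv_calculusSymbol_le (NNReal.coe_pos.2 hδ)
    (norm_dampedEvolution_le t s δ) x
  have h1 (u : ℝ) : radialIntegral (dampedEvolution t s δ) u = radialProfile s δ (u - t) :=
    radialIntegral_eq_laplace (fun k hk => by rw [dampedEvolution_apply, abs_of_pos hk]) u
  have h2 (u : ℝ) : radialIntegral (fun r => dampedEvolution t s δ (-r)) u =
      radialProfile s δ (u - -t) :=
    radialIntegral_eq_laplace (fun k hk => by
      rw [dampedEvolution_apply, abs_neg, abs_of_pos hk]
      simp [bracket]) u
  simpa only [h1, h2] using h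

theorem abs_le_norm_sub_I_mul (δ u : ℝ) : |u| ≤ ‖(δ - Complex.I * (u : ℂ) : ℂ)‖ := by
  have := Complex.abs_im_le_norm (δ - Complex.I * (u : ℂ))
  simpa using this

theorem re_sub_I_mul (δ u : ℝ) : (δ - Complex.I * (u : ℂ) : ℂ).re = δ := by simp

/-! ### Kernel bounds uniform in the damping. -/

/-- The dispersive bound for the kernel. -/
theorem exists_kernel_le_rpow (s : ℝ≥0) (hs : 3 / 2 < s) : ∃ C : ℝ≥0, ∀ (δ : ℝ≥0), 0 < δ →
    ∀ (t : ℝ), t ≠ 0 → ∀ x : Plane,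
    ‖𝓕⁻ (calculusSymbol (dampedEvolution t s δ)) x‖ ≤ C * |t| ^ (-(1 / 2) : ℝ) := by
  have hs' : (3 / 2 : ℝ) < s := by exact_mod_cast hs
  -- The exponents used are `a = 1/2 ± e`. The bound `e < s - 3/2` gives `1 + a ≤ s`, and `e < 1/4`
  -- keeps `a` inside `(0, 1)`.
  obtain ⟨e, he0, he1⟩ := exists_between (lt_min (sub_pos.2 hs') (by norm_num : (0 : ℝ) < 1 / 4))
  have hes : e < s - 3 / 2 := he1.trans_le (min_le_left _ _)
  have he4 : e < 1 / 4 := he1.trans_le (min_le_right _ _)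
  set A : ℝ → ℝ := fun a => (1 + s) * (1 / (1 - a) + 1 + 1 / a) with hA
  have hAnn (a : ℝ) (h0 : 0 < a) (h1 : a < 1) : 0 ≤ A a := by
    have : 0 < 1 - a := by linarith
    simp only [hA]
    positivity
  have hA1 := hAnn (1 / 2 + e) (by linarith) (by linarith)
  have hA2 := hAnn (1 / 2 - e) (by linarith) (by linarith)
  set C₀ : ℝ := A (1 / 2 + e) + A (1 / 2 - e) with hC₀
  have hC₀nn : 0 ≤ C₀ := add_nonneg hA1 hA2
  have hprof (δ : ℝ≥0) (hδ : 0 < δ) (a : ℝ) (h0 : 0 < a) (h1 : a < 1) (has : 1 + a ≤ s)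
      (haC : A a ≤ C₀) (u : ℝ) (hu : u ≠ 0) : ‖radialProfile s δ u‖ ≤ C₀ * |u| ^ (a - 1) := by
    refine (norm_radialProfile_le _ _ _).trans
      ((norm_laplace_amplitude_le_rpow h0 h1 has ?_).trans ?_)
    · rw [re_sub_I_mul]
      exact hδ
    -- Uniformity in `δ` enters here: only `|u| ≤ |z|` is used, and the exponent `a - 1` is
    -- negative.
    · exact mul_le_mul haC (Real.rpow_le_rpow_of_nonpos (abs_pos.2 hu)
        (abs_le_norm_sub_I_mul δ u) (by linarith)) (Real.rpow_nonneg (norm_nonneg _) _) hC₀nn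
  have hM : 0 ≤ ∫ v, majorant e v := integral_nonneg (majorant_nonneg e)
  set D : ℝ := 2 * Real.pi * C₀ * ∫ v, majorant e v with hD
  have hDnn : 0 ≤ D := by positivity
  refine ⟨NNReal.mk (2 * D) (by positivity), fun δ hδ t ht x => ?_⟩
  have hbd (τ : ℝ) (hτ : τ ≠ 0) :
      ∫ θ in (-Real.pi)..Real.pi, ‖radialProfile s δ (‖x‖ * Real.cos θ - τ)‖ ≤
        D * |τ| ^ (-(1 / 2) : ℝ) := by
    refine integral_norm_comp_cos_le hC₀nn he0 (by linarith) (fun u hu => ?_) (fun u hu => ?_)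
      (norm_nonneg x) hτ
    · refine (hprof δ hδ (1 / 2 + e) (by linarith) (by linarith) (by linarith)
        (by linarith) u hu).trans_eq ?_
      ring_nf
    · refine (hprof δ hδ (1 / 2 - e) (by linarith) (by linarith) (by linarith)
        (by linarith) u hu).trans_eq ?_
      ring_nf
  have h1 := hbd t ht
  have h2 := hbd (-t) (neg_ne_zero.2 ht)
  rw [abs_neg] at h2
  refine (norm_fourierInv_dampedEvolution_le t s hδ x).trans ((add_le_add h1 h2).trans_eq ?_)
  rw [NNReal.coe_mk]
  ring

/-- Two angular integrals over an interval of length `2π` give the factor `4π`. -/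
theorem norm_fourierInv_dampedEvolution_le_of_profile {t : ℝ} {s δ : ℝ≥0} (hδ : 0 < δ) {x : Plane}
    {B : ℝ} (h : ∀ τ, |τ| = |t| → ∀ θ : ℝ, ‖radialProfile s δ (‖x‖ * Real.cos θ - τ)‖ ≤ B) :
    ‖𝓕⁻ (calculusSymbol (dampedEvolution t s δ)) x‖ ≤ 4 * Real.pi * B := by
  have hbd (τ : ℝ) (hτ : |τ| = |t|) :
      ∫ θ in (-Real.pi)..Real.pi, ‖radialProfile s δ (‖x‖ * Real.cos θ - τ)‖ ≤
        B * |Real.pi - -Real.pi| := by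
    refine (Real.le_norm_self _).trans (intervalIntegral.norm_integral_le_of_norm_le_const fun θ _ => ?_)
    rw [norm_norm]
    exact h τ hτ θ
  have h1 := hbd t rfl
  have h2 := hbd (-t) (abs_neg t)
  refine (norm_fourierInv_dampedEvolution_le t s hδ x).trans ((add_le_add h1 h2).trans_eq ?_)
  rw [abs_of_pos (by linarith [Real.pi_pos])]
  ring

theorem exists_kernel_le (s : ℝ≥0) (hs : 2 < s) : ∃ C : ℝ≥0, ∀ (δ : ℝ≥0), 0 < δ →
    ∀ (t : ℝ) (x : Plane), ‖𝓕⁻ (calculusSymbol (dampedEvolution t s δ)) x‖ ≤ C := by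
  have hs' : (2 : ℝ) < s := by exact_mod_cast hs
  have hI : 0 ≤ ∫ k in Ioi (0 : ℝ), bracket k ^ (-((s : ℝ) - 1)) :=
    integral_nonneg fun k => Real.rpow_nonneg (bracket_pos k).le _
  refine ⟨NNReal.mk (4 * Real.pi * ∫ k in Ioi (0 : ℝ), bracket k ^ (-((s : ℝ) - 1))) (by positivity),
    fun δ hδ t x => norm_fourierInv_dampedEvolution_le_of_profile hδ fun τ _ θ =>
      (norm_radialProfile_le _ _ _).trans (norm_laplace_amplitude_le hs' ?_)⟩
  rw [re_sub_I_mul]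
  exact hδ

/-- Inside the light cone the kernel decays like `t^{-2}`. -/
theorem exists_kernel_le_of_norm_le (s : ℝ≥0) (hs : 2 < s) : ∃ C : ℝ≥0, ∀ (δ : ℝ≥0), 0 < δ →
    ∀ (t : ℝ), t ≠ 0 → ∀ x : Plane, ‖x‖ ≤ |t| / 2 →
    ‖𝓕⁻ (calculusSymbol (dampedEvolution t s δ)) x‖ ≤ C * (|t| ^ 2)⁻¹ := by
  have hs' : (2 : ℝ) < s := by exact_mod_cast hs
  set A : ℝ := 1 + (3 * s + s * (s + 2)) * ∫ k in Ioi (0 : ℝ), bracket k ^ (-((s : ℝ) + 1)) with hA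
  have hI : 0 ≤ ∫ k in Ioi (0 : ℝ), bracket k ^ (-((s : ℝ) + 1)) :=
    integral_nonneg fun k => Real.rpow_nonneg (bracket_pos k).le _
  have hA0 : 0 ≤ A := by positivity
  refine ⟨NNReal.mk (4 * Real.pi * (A * 4)) (by positivity), fun δ hδ t ht x hx => ?_⟩
  have ht0 : 0 < |t| := abs_pos.2 ht
  refine (norm_fourierInv_dampedEvolution_le_of_profile hδ (B := A * (4 * (|t| ^ 2)⁻¹))
    fun τ hτ θ => ?_).trans_eq (by rw [NNReal.coe_mk]; ring)
  refine (norm_radialProfile_le _ _ _).trans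
    ((norm_laplace_amplitude_le_inv_sq hs' (by rw [re_sub_I_mul]; exact hδ)).trans
      (mul_le_mul_of_nonneg_left ?_ hA0))
  -- Inside the cone `|x| ≤ |t|/2` the phase stays away from zero for every angle.
  have h1 : |t| / 2 ≤ |‖x‖ * Real.cos θ - τ| := by
    have h2 : |‖x‖ * Real.cos θ| ≤ ‖x‖ := by
      rw [abs_mul, abs_norm]
      exact mul_le_of_le_one_right (norm_nonneg _) (Real.abs_cos_le_one θ)
    have h3 := abs_sub_abs_le_abs_sub τ (‖x‖ * Real.cos θ)
    rw [abs_sub_comm] at h3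
    linarith
  have h4 := h1.trans (abs_le_norm_sub_I_mul δ _)
  have h5 : (|t| / 2) ^ 2 ≤ _ := pow_le_pow_left₀ (by positivity) h4 2
  refine (inv_anti₀ (by positivity) h5).trans_eq ?_
  rw [div_pow, inv_div]
  ring

theorem norm_sub_le_bracket_mul_bracket (x y : Plane) : ‖x - y‖ ≤ bracket ‖x‖ * bracket ‖y‖ := by
  refine (norm_sub_le x y).trans ?_
  rw [bracket, bracket, ← Real.sqrt_mul (by positivity)]
  refine Real.le_sqrt_of_sq_le ?_
  -- With `a = |x|` and `b = |y|`, `(1 + a²)(1 + b²) - (a + b)² = (1 - ab)²`.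
  nlinarith [sq_nonneg (1 - ‖x‖ * ‖y‖)]

/-- The weighted kernel of the damped evolution. -/
theorem exists_weighted_kernel_le (s : ℝ≥0) (hs : 2 < s) : ∃ C : ℝ≥0, ∀ γ : ℝ≥0, γ ≤ 3 / 2 →
    ∀ (t : ℝ) (δ : ℝ≥0), 0 < δ → ∀ x y : Plane, bracket ‖x‖ ^ (-(γ : ℝ)) *
      ‖𝓕⁻ (calculusSymbol (dampedEvolution t s δ)) (x - y)‖ * bracket ‖y‖ ^ (-(γ : ℝ)) ≤
      C * bracket t ^ (-(1 / 2) - (γ : ℝ)) := by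
  obtain ⟨C₁, hC₁⟩ := exists_kernel_le_rpow s (lt_trans (by norm_num) hs)
  obtain ⟨C₂, hC₂⟩ := exists_kernel_le s hs
  obtain ⟨C₃, hC₃⟩ := exists_kernel_le_of_norm_le s hs
  -- One summand per regime: `C₁` for large `t` and `|x - y| > |t|/2`, `C₂` for `|t| ≤ 1`, `C₃` for
  -- large `t` and `|x - y| ≤ |t|/2`.
  refine ⟨16 * C₁ + 4 * C₂ + 4 * C₃, fun γ hγ t δ hδ x y => ?_⟩
  have hγ0 : (0 : ℝ) ≤ γ := γ.2
  have hγ' : (γ : ℝ) ≤ 3 / 2 := by exact_mod_cast hγ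
  set K := ‖𝓕⁻ (calculusSymbol (dampedEvolution t s δ)) (x - y)‖ with hK
  have hK0 : 0 ≤ K := norm_nonneg _
  set b := bracket t with hb
  have hb1 : 1 ≤ b := one_le_bracket t
  have hb0 : 0 < b := bracket_pos t
  set p := b ^ (-(1 / 2) - (γ : ℝ)) with hp
  have hp0 : 0 < p := Real.rpow_pos_of_pos hb0 _
  have hbsq : b ^ 2 = 1 + |t| ^ 2 := by rw [sq_abs]; exact bracket_sq t
  have hw (z : Plane) : bracket ‖z‖ ^ (-(γ : ℝ)) ≤ 1 :=
    Real.rpow_le_one_of_one_le_of_nonpos (one_le_bracket _) (by linarith)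
  have hw0 (z : Plane) : 0 ≤ bracket ‖z‖ ^ (-(γ : ℝ)) := Real.rpow_nonneg (bracket_pos _).le _
  have hle : bracket ‖x‖ ^ (-(γ : ℝ)) * K * bracket ‖y‖ ^ (-(γ : ℝ)) ≤ K :=
    (mul_le_of_le_one_right (mul_nonneg (hw0 x) hK0) (hw y)).trans
      (mul_le_of_le_one_left hK0 (hw x))
  -- The decay `⟨t⟩^{-2}` inside the cone suffices exactly when `1/2 + γ ≤ 2`.
  have hp2 : (b ^ 2)⁻¹ ≤ p := by
    rw [← Real.rpow_natCast, ← Real.rpow_neg hb0.le]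
    exact Real.rpow_le_rpow_of_exponent_le hb1 (by push_cast; linarith)
  have h1p : 0 ≤ C₁ * p := mul_nonneg C₁.2 hp0.le
  have h2p : 0 ≤ C₂ * p := mul_nonneg C₂.2 hp0.le
  have h3p : 0 ≤ C₃ * p := mul_nonneg C₃.2 hp0.le
  suffices h : bracket ‖x‖ ^ (-(γ : ℝ)) * K * bracket ‖y‖ ^ (-(γ : ℝ)) ≤ 16 * (C₁ * p) ∨
      bracket ‖x‖ ^ (-(γ : ℝ)) * K * bracket ‖y‖ ^ (-(γ : ℝ)) ≤ 4 * (C₂ * p) ∨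
      bracket ‖x‖ ^ (-(γ : ℝ)) * K * bracket ‖y‖ ^ (-(γ : ℝ)) ≤ 4 * (C₃ * p) by
    push_cast
    rcases h with h | h | h <;> linarith
  rcases le_or_gt |t| 1 with ht | ht
  · refine Or.inr (Or.inl (hle.trans ((hC₂ δ hδ t (x - y)).trans ?_)))
    have hb2 : b ^ 2 ≤ 4 := by nlinarith [abs_nonneg t]
    have : (4 : ℝ)⁻¹ ≤ p := (inv_anti₀ (by positivity) hb2).trans hp2
    nlinarith [C₂.2]
  have ht0 : t ≠ 0 := abs_pos.1 (zero_lt_one.trans ht)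
  have hbt : b ≤ 2 * |t| := by nlinarith
  rcases le_or_gt ‖x - y‖ (|t| / 2) with hxy | hxy
  · refine Or.inr (Or.inr (hle.trans ((hC₃ δ hδ t ht0 (x - y) hxy).trans ?_)))
    have h4 : (|t| ^ 2)⁻¹ ≤ 4 * (b ^ 2)⁻¹ := by
      rw [← div_eq_mul_inv, le_div_iff₀ (by positivity), inv_mul_le_iff₀ (by positivity)]
      nlinarith
    calc C₃ * (|t| ^ 2)⁻¹ ≤ C₃ * (4 * p) :=
          mul_le_mul_of_nonneg_left (h4.trans (by linarith)) C₃.2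
      _ = 4 * (C₃ * p) := by ring
  · refine Or.inl ?_
    have hbb : b / 4 ≤ bracket ‖x‖ * bracket ‖y‖ := by
      have := norm_sub_le_bracket_mul_bracket x y
      linarith
    -- The `8` is `4^{3/2}`, which bounds `4^γ` and so makes the constant independent of `γ`.
    have hww : bracket ‖x‖ ^ (-(γ : ℝ)) * bracket ‖y‖ ^ (-(γ : ℝ)) ≤ 8 * b ^ (-(γ : ℝ)) := by
      rw [← Real.mul_rpow (bracket_pos _).le (bracket_pos _).le]
      refine (Real.rpow_le_rpow_of_nonpos (by positivity) hbb (by linarith)).trans ?_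
      rw [Real.div_rpow hb0.le (by norm_num), Real.rpow_neg (by norm_num : (0 : ℝ) ≤ 4), div_inv_eq_mul,
        mul_comm]
      refine mul_le_mul_of_nonneg_right ?_ (Real.rpow_nonneg hb0.le _)
      refine (Real.rpow_le_rpow_of_exponent_le (by norm_num) hγ').trans_eq ?_
      rw [show (4 : ℝ) = 2 ^ (2 : ℝ) by norm_num, ← Real.rpow_mul (by norm_num)]
      norm_num
    have hKb : K ≤ C₁ * (2 * b ^ (-(1 / 2) : ℝ)) := by
      refine (hC₁ δ hδ t ht0 (x - y)).trans (mul_le_mul_of_nonneg_left ?_ C₁.2)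
      refine (Real.rpow_le_rpow_of_nonpos (by positivity) (by linarith : b / 2 ≤ |t|)
        (by norm_num)).trans ?_
      rw [Real.div_rpow hb0.le (by norm_num), Real.rpow_neg (by norm_num : (0 : ℝ) ≤ 2), div_inv_eq_mul,
        mul_comm]
      refine mul_le_mul_of_nonneg_right ?_ (Real.rpow_nonneg hb0.le _)
      refine (Real.rpow_le_rpow_of_exponent_le (by norm_num)
        (by norm_num : (1 / 2 : ℝ) ≤ 1)).trans_eq (Real.rpow_one 2)
    calc bracket ‖x‖ ^ (-(γ : ℝ)) * K * bracket ‖y‖ ^ (-(γ : ℝ))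
        = (bracket ‖x‖ ^ (-(γ : ℝ)) * bracket ‖y‖ ^ (-(γ : ℝ))) * K := by ring
      _ ≤ (8 * b ^ (-(γ : ℝ))) * (C₁ * (2 * b ^ (-(1 / 2) : ℝ))) :=
          mul_le_mul hww hKb hK0 (by positivity)
      _ = 16 * (C₁ * p) := by
          rw [hp, sub_eq_add_neg, Real.rpow_add hb0]
          ring

end Dirac2D

end

theorem theorem2p1 :
    (∀ ε : ℝ≥0, 0 < ε → ∃ C : ℝ≥0, ∀ t : ℝ, t ≠ 0 →
      Dirac2D.normL1Linfty (Dirac2D.evolution t ∘L Dirac2D.smoothing (3 / 2 + ε))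
        ≤ C * ENNReal.ofReal (|t| ^ (-(1 / 2) : ℝ))) ∧
    (∀ ε : ℝ≥0, 0 < ε → ∃ C : ℝ≥0, ∀ γ : ℝ≥0, γ ≤ 3 / 2 → ∀ t : ℝ,
      Dirac2D.normL1Linfty
          (Dirac2D.weight γ ∘L Dirac2D.evolution t ∘L Dirac2D.smoothing (2 + ε) ∘L Dirac2D.weight γ)
        ≤ C * ENNReal.ofReal (Dirac2D.bracket t ^ (-(1 / 2) - (γ : ℝ)))) := by
  refine ⟨fun ε hε => ?_, fun ε hε => ?_⟩
  · obtain ⟨C, hC⟩ := Dirac2D.exists_kernel_le_rpow (3 / 2 + ε) (lt_add_of_pos_right _ hε)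
    refine ⟨C, fun t ht => ?_⟩
    -- The unweighted estimate is the case `γ = 0`, where both weights are the identity.
    have h := Dirac2D.normL1Linfty_weighted_evolution_le t (3 / 2 + ε) 0
      (B := C * (|t| ^ (-(1 / 2) : ℝ)).toNNReal) fun δ hδ x y => by
        rw [NNReal.coe_mul, Real.coe_toNNReal _ (Real.rpow_nonneg (abs_nonneg t) _)]
        simpa using hC δ hδ t ht (x - y)
    rw [Dirac2D.weight_zero, ContinuousLinearMap.id_comp, ContinuousLinearMap.comp_id,
      ENNReal.coe_mul] at h
    exact h
  · obtain ⟨C, hC⟩ := Dirac2D.exists_weighted_kernel_le (2 + ε) (lt_add_of_pos_right _ hε)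
    refine ⟨C, fun γ hγ t => ?_⟩
    have h := Dirac2D.normL1Linfty_weighted_evolution_le t (2 + ε) γ
      (B := C * (Dirac2D.bracket t ^ (-(1 / 2) - (γ : ℝ))).toNNReal) fun δ hδ x y => by
        rw [NNReal.coe_mul, Real.coe_toNNReal _ (Real.rpow_nonneg (Dirac2D.bracket_pos t).le _)]
        exact hC γ hγ t δ hδ x y
    rw [ENNReal.coe_mul] at h
    exact h
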